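/- Let $d\in\mathbb N$, let $\mathcal X=[0,1]^d$ carry the Euclidean distance, and let the label set $\mathcal Y$ have $M=2$ elements. Consider parameters $\zeta=(\alpha,L,\beta,C_\beta,C'_\beta,\tau,\mu_{\min},\mu_{\max})$ with $\alpha\in(0,1)$, $\beta>0$, $L,C_\beta,C'_\beta,\mu_{\max}\in(1,\infty)$, $\alpha\beta\le d$, $\mu_{\min}\in(0,1)$, $\tau\in[0,1]$ and $\mu_{\min}<\tau$. Let $\mathcal P_{c\ell}(\zeta)$ be the class of all probability measures $P$ on $\mathcal X\times\mathcal Y$ (the law of a pair $(X,Y)$, with marginal $P_X$ on $\mathcal X$), together with a version $\eta=(\eta_y)_{y\in\mathcal Y}$, defined on all of $\mathcal X$, of the regression function $\eta_y(x)=P(Y=y\mid X=x)$ (so $\eta_y\geq 0$ and $\sum_y\eta_y=1$), such that: - (Hölder) $|\eta_y(x)-\eta_y(z)|\le L\|x-z\|^{\alpha}$ for all $x,z\in\mathcal X$ and $y\in\mathcal Y$; - (refined margin noise) for all $\epsilon>0$, $P_X(\Delta_\eta(X)\le\epsilon)\le C_\beta\epsilon^\beta$ and $P_X(\Delta'_\eta(X)\le\epsilon)\le\tau+C'_\beta\epsilon^\beta$,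 where $\Delta_\eta(x)$ is the smallest positive value of $\max_{y'}\eta_{y'}(x)-\eta_y(x)$ over $y\in\mathcal Y$ ($\infty$ if there is none), and $\Delta'_\eta(x)$ is the difference of the largest and the second largest (counted with multiplicity) of the values $\eta_y(x)$, $y\in\mathcal Y$; - (strong density) $P_X$ has a density $p_X$ with respect to Lebesgue measure such that $\mu_{\min}\le p_X(x)\le\mu_{\max}$ for all $x$ with $p_X(x)>0$. An active classifier $\hat g_n$ with budget $n$ successively chooses points $X_1,\dots,X_n\in\mathcal X$, each $X_t$ depending measurably on $(X_1,Y_1),\dots,(X_{t-1},Y_{t-1})$ and possibly on internal randomness; given $X_t=x$ and the past, the returned label $Y_t$ equals $y$ with probability $\eta_y(x)$. It outputs a classifier $\hat g_n:\mathcal X\to\mathcal Y$ depending measurably on $(X_1,Y_1),\dots,(X_n,Y_n)$ and on the internal randomness. Let $R_{c\ell}(g)=P(g(X)\ne Y)$, and let $g^*$ be the Bayes classifier, $g^*(x)\in\operatorname{argmax}_{y}\eta_y(x)$. Then there exist constants $C_{c\ell},C'_{c\ell}>0$, depending only on $d,\alpha,L,\beta,C_\beta,C'_\beta,\mu_{\max}$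 (in particular not on $n$, $\tau$ or $\mu_{\min}$), such that for every $n\ge1$ $$\inf_{\hat g_n}\ \sup_{P\in\mathcal P_{c\ell}(\zeta)}\ \mathbb E\bigl[R_{c\ell}(\hat g_n)-R_{c\ell}(g^*)\bigr]\ \ge\ \min(a_{n,\tau},a'_{n,\tau}),$$ where the infimum runs over all active classifiers with budget $n$, and $$a_{n,\tau}=C_{c\ell}\max\left(\left(\tfrac{\tau}{n}\right)^{\frac{\alpha(\beta+1)}{2\alpha+d}},\left(\tfrac1n\right)^{\frac{\alpha(\beta+1)}{2\alpha+d-\alpha\beta}}\right),\qquad a'_{n,\tau}=C'_{c\ell}\max\left(\left(\tfrac1n\right)^{\frac{\alpha(\beta+1)}{2\alpha+d}},\left(\tfrac1\tau\right)^{\frac{\alpha(\beta+1)}{2\alpha+d}}\left(\tfrac1n\right)^{\frac{\alpha(\beta+1)}{2\alpha+d-\alpha\beta}}\right).$$ -/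

import Mathlib

open MeasureTheory

noncomputable section

namespace ActiveClassification

/-- The set `[0,1]^d` in Euclidean space. -/
def cube (d : ℕ) : Set (EuclideanSpace ℝ (Fin d)) := {x | ∀ i, x i ∈ Set.Icc (0 : ℝ) 1}

/-- The instance space `[0,1]^d`, with the Euclidean distance. -/
abbrev Cube (d : ℕ) : Type := cube d

/-- `η` is (an everywhere defined version of) the regression function of the law `P` of `(X, Y)`:
`η x j` is the conditional probability that `Y = j` given `X = x`. -/
structure IsRegressionFunction {d M : ℕ} (P : Measure (Cube d × Fin M))
    (η : Cube d → Fin M → ℝ) : Prop where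
  measurable : ∀ j, Measurable fun x => η x j
  nonneg : ∀ x j, 0 ≤ η x j
  sum_eq_one : ∀ x, ∑ j, η x j = 1
  version : ∀ (j : Fin M) (A : Set (Cube d)), MeasurableSet A →
    P (A ×ˢ {j}) = ∫⁻ x in A, ENNReal.ofReal (η x j) ∂P.fst

/-- `max_{y'} η_{y'}(x) - η_y(x)`. -/
def labelGap {d M : ℕ} (η : Cube d → Fin M → ℝ) (x : Cube d) (y : Fin M) : ℝ :=
  (⨆ y', η x y') - η x y

/-- The smallest positive value of `labelGap η x y` over the labels `y`, and `∞` if there is none. -/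
def margin {d M : ℕ} (η : Cube d → Fin M → ℝ) (x : Cube d) : EReal :=
  ⨅ (y : Fin M) (_ : 0 < labelGap η x y), (labelGap η x y : EReal)

/-- The values of a vector in decreasing order. -/
def decreasing {M : ℕ} (v : Fin M → ℝ) : Fin M → ℝ := v ∘ Tuple.sort (fun y => -v y)

/-- The largest minus the second largest (with multiplicity) of the values `η_y(x)`. -/
def margin' {d M : ℕ} [hM : M.AtLeastTwo] (η : Cube d → Fin M → ℝ) (x : Cube d) : ℝ :=
  decreasing (η x) ⟨0, lt_of_lt_of_le two_pos hM.prop⟩ -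
    decreasing (η x) ⟨1, lt_of_lt_of_le one_lt_two hM.prop⟩

/-- Hölder smoothness of every component of the regression function, on the whole cube. -/
def HolderSmooth {d M : ℕ} (η : Cube d → Fin M → ℝ) (α L : ℝ) : Prop :=
  ∀ x z y, |η x y - η z y| ≤ L * dist x z ^ α

/-- The refined margin noise assumption for the marginal `μ` and the regression function `η`. -/
def RefinedMargin {d M : ℕ} [M.AtLeastTwo] (μ : Measure (Cube d)) (η : Cube d → Fin M → ℝ)
    (β Cβ Cβ' τ : ℝ) : Prop :=
  ∀ ε : ℝ, 0 < ε →
    μ {x | margin η x ≤ (ε : EReal)} ≤ ENNReal.ofReal (Cβ * ε ^ β) ∧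
    μ {x | margin' η x ≤ ε} ≤ ENNReal.ofReal (τ + Cβ' * ε ^ β)

/-- The Lebesgue measure on `[0,1]^d`. -/
def lebesgue (d : ℕ) : Measure (Cube d) := Measure.comap Subtype.val volume

/-- The strong density assumption. -/
def StrongDensity {d : ℕ} (μ : Measure (Cube d)) (μmin μmax : ℝ) : Prop :=
  ∃ p : Cube d → ℝ, Measurable p ∧ (∀ x, 0 ≤ p x) ∧
    μ = (lebesgue d).withDensity (fun x => ENNReal.ofReal (p x)) ∧
    ∀ x, 0 < p x → μmin ≤ p x ∧ p x ≤ μmax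

/-- The parameter `ζ`. -/
structure Params where
  α : ℝ
  L : ℝ
  β : ℝ
  Cβ : ℝ
  Cβ' : ℝ
  τ : ℝ
  μmin : ℝ
  μmax : ℝ

/-- The class of classification measures with parameter `ζ`. A member is a law `P` of `(X, Y)`
together with its regression function `η`. The latter is recorded because a learner may query
points outside the support of `X`, where `P` alone does not determine `η`. -/
structure InClass {d M : ℕ} [M.AtLeastTwo] (ζ : Params)
    (P : Measure (Cube d × Fin M)) (η : Cube d → Fin M → ℝ) : Prop where
  prob : IsProbabilityMeasure P
  regression : IsRegressionFunction P η
  smooth : HolderSmooth η ζ.α ζ.L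
  margin : RefinedMargin P.fst η ζ.β ζ.Cβ ζ.Cβ' ζ.τ
  density : StrongDensity P.fst ζ.μmin ζ.μmax

/-- The misclassification risk `P(g(X) ≠ Y)`. -/
def risk {d M : ℕ} (P : Measure (Cube d × Fin M)) (g : Cube d → Fin M) : ℝ :=
  P.real {q | g q.1 ≠ q.2}

theorem argmax_nonempty {M : ℕ} [hM : M.AtLeastTwo] (v : Fin M → ℝ) :
    (Finset.univ.filter fun y => ∀ y', v y' ≤ v y).Nonempty := by
  obtain ⟨y, -, hy⟩ := Finset.exists_max_image Finset.univ v
    ⟨⟨0, lt_of_lt_of_le two_pos hM.prop⟩, Finset.mem_univ _⟩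
  exact ⟨y, by simpa using hy⟩

/-- The Bayes classifier: a label that maximizes `η_y(x)` (the first one, in case of ties). -/
def bayes {d M : ℕ} [M.AtLeastTwo] (η : Cube d → Fin M → ℝ) (x : Cube d) : Fin M :=
  (Finset.univ.filter fun y => ∀ y', η x y' ≤ η x y).min' (argmax_nonempty (η x))

/-- The excess misclassification risk of `g`. -/
def excessRisk {d M : ℕ} [M.AtLeastTwo] (P : Measure (Cube d × Fin M))
    (η : Cube d → Fin M → ℝ) (g : Cube d → Fin M) : ℝ :=
  risk P g - risk P (bayes η)

/-- An active learning algorithm with `n` label requests. All its internal randomness is a seed.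
The next query point is a function of the seed and of the pairs (query, label) seen so far, and the
final classifier is a function of the seed and of all `n` pairs. -/
structure ActiveClassifier (d M n : ℕ) where
  Seed : Type
  seedSpace : MeasurableSpace Seed
  seedLaw : Measure Seed
  seedProb : IsProbabilityMeasure seedLaw
  query : (t : Fin n) → Seed → (Fin t → Cube d × Fin M) → Cube d
  query_measurable : ∀ t : Fin n,
    Measurable fun q : Seed × (Fin t → Cube d × Fin M) => query t q.1 q.2
  classify : Seed → (Fin n → Cube d × Fin M) → Cube d → Fin M
  classify_measurable :
    Measurable fun q : (Seed × (Fin n → Cube d × Fin M)) × Cube d => classify q.1.1 q.1.2 q.2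

namespace ActiveClassifier

variable {d M n : ℕ}

/-- The first `t` pairs (query, label) when the seed is `ω` and the answers are `y`. -/
def history (A : ActiveClassifier d M n) (ω : A.Seed) (y : Fin n → Fin M) :
    (t : ℕ) → t ≤ n → Fin t → Cube d × Fin M
  | 0, _ => Fin.elim0
  | t + 1, ht =>
    Fin.snoc (α := fun _ => Cube d × Fin M) (A.history ω y t (Nat.le_of_succ_le ht))
      (A.query ⟨t, ht⟩ ω (A.history ω y t (Nat.le_of_succ_le ht)), y ⟨t, ht⟩)

/-- The sample `S_n` when the seed is `ω` and the answers are `y`. -/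
def sample (A : ActiveClassifier d M n) (ω : A.Seed) (y : Fin n → Fin M) :
    Fin n → Cube d × Fin M :=
  A.history ω y n le_rfl

/-- The probability, given the seed `ω`, that the successive answers are `y`: a request at `x` is
answered by the label `j` with probability `η x j`, independently of the past given `x`. -/
def answerProb (A : ActiveClassifier d M n) (η : Cube d → Fin M → ℝ) (ω : A.Seed)
    (y : Fin n → Fin M) : ℝ :=
  ∏ t, η (A.sample ω y t).1 (y t)

/-- The expectation, over the seed and the answers, of the excess risk of the final classifier. -/
def expectedExcessRisk [M.AtLeastTwo] (A : ActiveClassifier d M n)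
    (P : Measure (Cube d × Fin M)) (η : Cube d → Fin M → ℝ) : ℝ :=
  letI := A.seedSpace
  ∫ ω, ∑ y : Fin n → Fin M,
    A.answerProb η ω y * excessRisk P η (A.classify ω (A.sample ω y)) ∂A.seedLaw

end ActiveClassifier

/-- The minimax expected excess risk over the class with parameter `ζ`, for `n` label requests. -/
def minimaxExcessRisk (d M : ℕ) [M.AtLeastTwo] (ζ : Params) (n : ℕ) : EReal :=
  ⨅ A : ActiveClassifier d M n,
    ⨆ (P : Measure (Cube d × Fin M)) (η : Cube d → Fin M → ℝ) (_ : InClass ζ P η),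
      (A.expectedExcessRisk P η : EReal)

end ActiveClassification

end

/-! The bound holds with `a_{n,τ}` alone on the right; the minimum with `a'_{n,τ}` is then
immediate. It comes from hard laws with `f = η₁ - η₀` unknown in sign on many small cells.

Hard laws. The corner `[0, K r]^d` is cut into `K^d` cells of mesh `r`. On cell `j`, `f` is `σ j ∈
{-1, 0, 1}` times a bump with a plateau of height `H ≍ r^α`; away from the corner `f` grows like the
`α`-th power of the distance to it, up to 1. The marginal is uniform on small balls inside the
plateaus together with the points of sup norm above `2 K r`. Zero cells are ties: the first margin
condition ignores them, the second allows them mass `τ`. If `k` cells are active, their mass is of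
order `k r^d` at margin `H`, so `k r^d ≤ r^(α β)` suffices there; far from the corner `f ≤ ε < 1`
forces a volume at most `ε^(d/α) ≤ ε^β`, by `α β ≤ d`. The density is at least 1 on its support, so
`μmin` never enters the constants.

Information. A label from an active cell carries divergence of order `H²`, and the `n` requests are
shared among the cells. If `n r^(2α)` is at most a small multiple of `K^d`, the sign of a typical
cell stays undetermined (`le_sum_lik_test`), and the expected excess risk is of order `k H r^d ≍
r^(α(β+1))`. Both signs of a cell are compared with one reference law, under which the visits are
counted, so that the budget can be summed over the cells.

Two families. With all cells active, `K^d r^d ≍ r^(α β)` and `r ≍ n^(-1/(2α+d-αβ))`; see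
`card_mul_le_sum_fullSigns`. With about `r^(αβ-d)` active cells hidden among `K^d ≍ τ r^(-d)`, the
learner must search them all and `r ≍ (τ/n)^(1/(2α+d))`; see `card_mul_le_sum_sparseSigns`. The
second family needs `r^(α β) ≲ τ`; when this fails, the first rate is the larger one anyway. -/

noncomputable section

namespace ActiveClassification

/-! ### Adaptive samples under a deterministic query rule -/

section Tree

variable {X : Type*} {M : ℕ}

theorem sum_fun_snoc {β : Type*} [Fintype β] {t : ℕ} (F : (Fin (t + 1) → β) → ℝ) :
    ∑ z, F z = ∑ z : Fin t → β, ∑ a, F (Fin.snoc (α := fun _ => β) z a) := by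
  rw [← (Fin.snocEquiv (fun _ : Fin (t + 1) => β)).sum_comp, Fintype.sum_prod_type,
    Finset.sum_comm]
  rfl

/-- The sample of the first `t` rounds, when the query rule is `π` and the answers are `z`. -/
def hist (π : (t : ℕ) → (Fin t → X × Fin M) → X) :
    (t : ℕ) → (Fin t → Fin M) → Fin t → X × Fin M
  | 0, _ => Fin.elim0
  | t + 1, z => Fin.snoc (α := fun _ => X × Fin M) (hist π t (Fin.init z))
      (π t (hist π t (Fin.init z)), z (Fin.last t))

/-- The point queried after the answers `z`. -/
def point (π : (t : ℕ) → (Fin t → X × Fin M) → X) (t : ℕ) (z : Fin t → Fin M) : X :=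
  π t (hist π t z)

/-- The probability of the answers `z`. -/
def lik (π : (t : ℕ) → (Fin t → X × Fin M) → X) (η : X → Fin M → ℝ) :
    (t : ℕ) → (Fin t → Fin M) → ℝ
  | 0, _ => 1
  | t + 1, z => lik π η t (Fin.init z) * η (point π t (Fin.init z)) (z (Fin.last t))

/-- The sum along a path of a function of the query and its answer. -/
def pathSum (π : (t : ℕ) → (Fin t → X × Fin M) → X) (l : X → Fin M → ℝ) :
    (t : ℕ) → (Fin t → Fin M) → ℝ
  | 0, _ => 0
  | t + 1, z => pathSum π l t (Fin.init z) + l (point π t (Fin.init z)) (z (Fin.last t))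

/-- The expected number of visits, weighted by `b`, in the first `n` rounds. -/
def visits (π : (t : ℕ) → (Fin t → X × Fin M) → X) (η : X → Fin M → ℝ) (b : X → ℝ) (n : ℕ) : ℝ :=
  ∑ t ∈ Finset.range n, ∑ z, lik π η t z * b (point π t z)

variable (π : (t : ℕ) → (Fin t → X × Fin M) → X) {η η' : X → Fin M → ℝ}

theorem lik_eq_prod (η : X → Fin M → ℝ) (t : ℕ) (z : Fin t → Fin M) :
    lik π η t z = ∏ i, η (hist π t z i).1 (z i) := by
  induction t with
  | zero => simp [lik]
  | succ t ih =>
    rw [lik, ih, Fin.prod_univ_castSucc]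
    simp [hist, point, Fin.init]

theorem lik_nonneg (h0 : ∀ x a, 0 ≤ η x a) (t : ℕ) (z : Fin t → Fin M) : 0 ≤ lik π η t z := by
  rw [lik_eq_prod]
  exact Finset.prod_nonneg fun _ _ => h0 _ _

theorem sum_lik (h1 : ∀ x, ∑ a, η x a = 1) (t : ℕ) : ∑ z, lik π η t z = 1 := by
  induction t with
  | zero => simp [lik]
  | succ t ih =>
    rw [sum_fun_snoc]
    simp only [lik, Fin.init_snoc, Fin.snoc_last, ← Finset.mul_sum, h1, mul_one, ih]

theorem lik_eq_mul_exp {l : X → Fin M → ℝ} (hl : ∀ x a, η' x a = η x a * Real.exp (l x a))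
    (t : ℕ) (z : Fin t → Fin M) : lik π η' t z = lik π η t z * Real.exp (pathSum π l t z) := by
  induction t with
  | zero => simp [lik, pathSum]
  | succ t ih => rw [lik, lik, pathSum, ih, hl, Real.exp_add]; ring

/-- Chain rule for the Kullback–Leibler divergence: given the past the query is fixed, so each round
adds the mean of `l` at the point queried. For a log-likelihood ratio `l`, the divergence of two
adaptive samples is thus at most `κ` times the expected visits to where they differ. -/
theorem le_sum_lik_mul_pathSum (h0 : ∀ x a, 0 ≤ η x a) (h1 : ∀ x, ∑ a, η x a = 1)
    {l : X → Fin M → ℝ} {b : X → ℝ} {κ : ℝ} (hl : ∀ x, -(κ * b x) ≤ ∑ a, η x a * l x a) (t : ℕ) :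
    -(κ * visits π η b t) ≤ ∑ z, lik π η t z * pathSum π l t z := by
  induction t with
  | zero => simp [visits, pathSum]
  | succ t ih =>
    have key : ∑ z, lik π η (t + 1) z * pathSum π l (t + 1) z =
        ∑ z, lik π η t z * pathSum π l t z +
          ∑ z, lik π η t z * ∑ a, η (point π t z) a * l (point π t z) a := by
      rw [sum_fun_snoc, ← Finset.sum_add_distrib]
      refine Finset.sum_congr rfl fun z _ => ?_
      simp only [lik, pathSum, Fin.init_snoc, Fin.snoc_last]
      have : ∀ a, lik π η t z * η (point π t z) a * (pathSum π l t z + l (point π t z) a) =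
          lik π η t z * pathSum π l t z * η (point π t z) a +
            lik π η t z * (η (point π t z) a * l (point π t z) a) := fun a => by ring
      rw [Finset.sum_congr rfl fun a _ => this a, Finset.sum_add_distrib, ← Finset.mul_sum,
        ← Finset.mul_sum, h1, mul_one]
    have hv : visits π η b (t + 1) = visits π η b t + ∑ z, lik π η t z * b (point π t z) := by
      rw [visits, Finset.sum_range_succ, ← visits]
    have : -(κ * ∑ z, lik π η t z * b (point π t z)) ≤
        ∑ z, lik π η t z * ∑ a, η (point π t z) a * l (point π t z) a := by
      rw [Finset.mul_sum, ← Finset.sum_neg_distrib]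
      refine Finset.sum_le_sum fun z _ => ?_
      have := mul_le_mul_of_nonneg_left (hl (point π t z)) (lik_nonneg π h0 t z)
      linarith
    rw [key, hv]
    linarith

theorem visits_nonneg (h0 : ∀ x a, 0 ≤ η x a) {b : X → ℝ} (hb : ∀ x, 0 ≤ b x) (n : ℕ) :
    0 ≤ visits π η b n :=
  Finset.sum_nonneg fun _ _ => Finset.sum_nonneg fun _ _ =>
    mul_nonneg (lik_nonneg π h0 _ _) (hb _)

/-- The budget constraint: a round queries a single point, whose weights total at most one. -/
theorem sum_visits_le (h0 : ∀ x a, 0 ≤ η x a) (h1 : ∀ x, ∑ a, η x a = 1) {J : Type*} [Fintype J]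
    {b : J → X → ℝ} (hb : ∀ x, ∑ j, b j x ≤ 1) (n : ℕ) : ∑ j, visits π η (b j) n ≤ n := by
  unfold visits
  rw [Finset.sum_comm]
  have : ∀ t ∈ Finset.range n, ∑ j, ∑ z, lik π η t z * b j (point π t z) ≤ 1 := by
    intro t _
    rw [Finset.sum_comm, ← sum_lik π h1 t]
    refine Finset.sum_le_sum fun z _ => ?_
    rw [← Finset.mul_sum]
    exact mul_le_of_le_one_right (lik_nonneg π h0 t z) (hb _)
  simpa using Finset.sum_le_sum this

end Tree

/-! ### Total variation and two-point tests -/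

section TotalVariation

variable {ι : Type*} [Fintype ι] {q q' l : ι → ℝ}

/-- A weak form of Pinsker's inequality. -/
theorem sq_sum_abs_sub_le (hq : ∀ i, 0 ≤ q i) (h1 : ∑ i, q i = 1) (h1' : ∑ i, q' i = 1)
    (hl : ∀ i, q' i = q i * Real.exp (l i)) {D : ℝ} (hD : -D ≤ ∑ i, q i * l i) :
    (∑ i, |q i - q' i|) ^ 2 ≤ 4 * D := by
  -- `e` is the square root of the likelihood ratio and `A = ∑ q e` the Hellinger affinity.
  -- Cauchy–Schwarz on `|1 - e²| = |1 - e| (1 + e)` gives `(2 - 2A)(2 + 2A)`, and `1 + x ≤ exp x`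
  -- gives `A ≥ 1 - D / 2`.
  set e : ι → ℝ := fun i => Real.exp (l i / 2)
  have he : ∀ i, Real.exp (l i) = e i ^ 2 := fun i => by
    simp only [e, ← Real.exp_nat_mul]; congr 1; push_cast; ring
  have hA : ∑ i, q i * e i ≥ 1 - D / 2 := by
    have : ∑ i, q i * (1 + l i / 2) ≤ ∑ i, q i * e i :=
      Finset.sum_le_sum fun i _ => mul_le_mul_of_nonneg_left
        (by simpa [e, add_comm] using Real.add_one_le_exp (l i / 2)) (hq i)
    have h2 : ∑ i, q i * (1 + l i / 2) = 1 + (∑ i, q i * l i) / 2 := by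
      have : ∀ i, q i * (1 + l i / 2) = q i + q i * l i / 2 := fun i => by ring
      rw [Finset.sum_congr rfl fun i _ => this i, Finset.sum_add_distrib, h1, Finset.sum_div]
    linarith
  have hq' : ∑ i, q i * e i ^ 2 = 1 := by
    rw [← h1']; exact Finset.sum_congr rfl fun i _ => by rw [hl, he]
  have hm : ∑ i, q i * (1 - e i) ^ 2 = 2 - 2 * ∑ i, q i * e i := by
    have : ∀ i, q i * (1 - e i) ^ 2 = q i + q i * e i ^ 2 - 2 * (q i * e i) := fun i => by ring
    rw [Finset.sum_congr rfl fun i _ => this i, Finset.sum_sub_distrib, Finset.sum_add_distrib, h1,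
      hq', Finset.mul_sum]
    norm_num
  have hp : ∑ i, q i * (1 + e i) ^ 2 = 2 + 2 * ∑ i, q i * e i := by
    have : ∀ i, q i * (1 + e i) ^ 2 = q i + q i * e i ^ 2 + 2 * (q i * e i) := fun i => by ring
    rw [Finset.sum_congr rfl fun i _ => this i, Finset.sum_add_distrib, Finset.sum_add_distrib, h1,
      hq', Finset.mul_sum]
    norm_num
  have hcs := Finset.sum_mul_sq_le_sq_mul_sq Finset.univ
    (fun i => Real.sqrt (q i) * |1 - e i|) (fun i => Real.sqrt (q i) * (1 + e i))
  have e1 : ∀ i, Real.sqrt (q i) * |1 - e i| * (Real.sqrt (q i) * (1 + e i)) = |q i - q' i| := by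
    intro i
    have hpos : 0 < 1 + e i := by positivity
    rw [hl, he, show q i - q i * e i ^ 2 = q i * ((1 - e i) * (1 + e i)) by ring, abs_mul, abs_mul,
      abs_of_nonneg (hq i), abs_of_pos hpos]
    linear_combination (|1 - e i| * (1 + e i)) * Real.mul_self_sqrt (hq i)
  simp only [e1, mul_pow, Real.sq_sqrt (hq _), sq_abs, hm, hp] at hcs
  have hB : 0 ≤ 2 - 2 * ∑ i, q i * e i := by
    rw [← hm]; exact Finset.sum_nonneg fun i _ => mul_nonneg (hq i) (sq_nonneg _)
  have hB' : 0 ≤ ∑ i, q i * e i := Finset.sum_nonneg fun i _ => mul_nonneg (hq i) (by positivity)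
  nlinarith

/-- Linearized by `s ≤ s² + 1/4`: unlike a square root, a bound linear in `D` can be summed over
cells against the total budget. -/
theorem sum_abs_sub_le (hq : ∀ i, 0 ≤ q i) (h1 : ∑ i, q i = 1) (h1' : ∑ i, q' i = 1)
    (hl : ∀ i, q' i = q i * Real.exp (l i)) {D : ℝ} (hD : -D ≤ ∑ i, q i * l i) :
    ∑ i, |q i - q' i| ≤ 1 / 4 + 4 * D := by
  nlinarith [sq_sum_abs_sub_le hq h1 h1' hl hD, sq_nonneg (∑ i, |q i - q' i| - 1 / 2)]

/-- Le Cam's two point bound. -/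
theorem le_sum_test {p p' : ι → ℝ} (h1 : ∑ i, p i = 1) (h1' : ∑ i, p' i = 1) {a : ι → ℝ}
    (ha0 : ∀ i, 0 ≤ a i) (ha1 : ∀ i, a i ≤ 1) :
    1 - (∑ i, |p i - p' i|) / 2 ≤ ∑ i, p i * (1 - a i) + ∑ i, p' i * a i := by
  rw [← Finset.sum_add_distrib]
  have : ∑ i, ((p i + p' i) / 2 - |p i - p' i| / 2) ≤ ∑ i, (p i * (1 - a i) + p' i * a i) := by
    refine Finset.sum_le_sum fun i _ => ?_
    have h1 := neg_abs_le (p i - p' i)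
    have h2 := le_abs_self (p i - p' i)
    nlinarith [ha0 i, ha1 i]
  rw [Finset.sum_sub_distrib, ← Finset.sum_div, ← Finset.sum_div, Finset.sum_add_distrib, h1,
    h1'] at this
  linarith

end TotalVariation

/-- The two point bound for an adaptive sample, in terms of a reference regression function. -/
theorem le_sum_lik_test {X : Type*} {M : ℕ} (π : (t : ℕ) → (Fin t → X × Fin M) → X)
    {η η₁ η₂ l₁ l₂ : X → Fin M → ℝ}
    (h0 : ∀ x a, 0 ≤ η x a) (h1 : ∀ x, ∑ a, η x a = 1)
    (hη₁ : ∀ x, ∑ a, η₁ x a = 1) (hη₂ : ∀ x, ∑ a, η₂ x a = 1)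
    {b : X → ℝ} {κ : ℝ}
    (hl₁ : ∀ x a, η₁ x a = η x a * Real.exp (l₁ x a))
    (hl₂ : ∀ x a, η₂ x a = η x a * Real.exp (l₂ x a))
    (hk₁ : ∀ x, -(κ * b x) ≤ ∑ a, η x a * l₁ x a)
    (hk₂ : ∀ x, -(κ * b x) ≤ ∑ a, η x a * l₂ x a) (n : ℕ)
    {a : (Fin n → Fin M) → ℝ} (ha0 : ∀ y, 0 ≤ a y) (ha1 : ∀ y, a y ≤ 1) :
    3 / 4 - 4 * κ * visits π η b n ≤
      ∑ y, lik π η₁ n y * (1 - a y) + ∑ y, lik π η₂ n y * a y := by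
  have t1 := sum_abs_sub_le (lik_nonneg π h0 n) (sum_lik π h1 n) (sum_lik π hη₁ n)
    (lik_eq_mul_exp π hl₁ n) (le_sum_lik_mul_pathSum π h0 h1 hk₁ n)
  have t2 := sum_abs_sub_le (lik_nonneg π h0 n) (sum_lik π h1 n) (sum_lik π hη₂ n)
    (lik_eq_mul_exp π hl₂ n) (le_sum_lik_mul_pathSum π h0 h1 hk₂ n)
  have t3 := le_sum_test (sum_lik π hη₁ n) (sum_lik π hη₂ n) ha0 ha1
  have t4 : ∑ y, |lik π η₁ n y - lik π η₂ n y| ≤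
      ∑ y, |lik π η n y - lik π η₁ n y| + ∑ y, |lik π η n y - lik π η₂ n y| := by
    rw [← Finset.sum_add_distrib]
    refine Finset.sum_le_sum fun y _ => ?_
    rw [abs_sub_comm (lik π η n y) (lik π η₁ n y)]
    exact abs_sub_le _ _ _
  -- Both distances to the reference are at most `1/4 + 4 κ V`, with `V` the visits; half their sum
  -- leaves `3/4 - 4 κ V`.
  linarith

/-! ### From active classifiers to query rules, and averaging over laws -/

namespace ActiveClassifier

variable {d M n : ℕ}

/-- The query rule of an active classifier with a fixed seed, extended to all rounds. -/
def policy (A : ActiveClassifier d M n) (ω : A.Seed) (t : ℕ) (h : Fin t → Cube d × Fin M) :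
    Cube d :=
  -- The origin is a dummy query for rounds beyond the budget, which never enter the sample.
  if ht : t < n then A.query ⟨t, ht⟩ ω h else ⟨0, fun _ => by simp⟩

theorem history_eq (A : ActiveClassifier d M n) (ω : A.Seed) (y : Fin n → Fin M) (t : ℕ)
    (ht : t ≤ n) :
    A.history ω y t ht = hist (A.policy ω) t (fun i => y (Fin.castLE ht i)) := by
  induction t with
  | zero => rfl
  | succ t ih =>
    have h := ih (Nat.le_of_succ_le ht)
    have hi : Fin.init (α := fun _ => Fin M) (fun i => y (Fin.castLE ht i)) =
        fun i => y (Fin.castLE (Nat.le_of_succ_le ht) i) := rfl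
    rw [history, hist, hi, ← h, policy, dif_pos (Nat.lt_of_succ_le ht)]
    rfl

theorem answerProb_eq_lik (A : ActiveClassifier d M n) (η : Cube d → Fin M → ℝ) (ω : A.Seed)
    (y : Fin n → Fin M) : A.answerProb η ω y = lik (A.policy ω) η n y := by
  rw [answerProb, lik_eq_prod, sample, history_eq]
  rfl

theorem measurable_history (A : ActiveClassifier d M n) (y : Fin n → Fin M) (t : ℕ) (ht : t ≤ n) :
    letI := A.seedSpace
    Measurable fun ω => A.history ω y t ht := by
  let := A.seedSpace
  induction t with
  | zero => exact measurable_pi_iff.2 fun i => i.elim0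
  | succ t ih =>
    have h := ih (Nat.le_of_succ_le ht)
    refine measurable_pi_iff.2 fun i => ?_
    refine Fin.lastCases ?_ (fun i => ?_) i
    · simp only [history, Fin.snoc_last]
      exact ((A.query_measurable ⟨t, ht⟩).comp (measurable_id.prodMk h)).prodMk measurable_const
    · simp only [history, Fin.snoc_castSucc]
      exact measurable_pi_iff.1 h i

theorem measurable_sample (A : ActiveClassifier d M n) (y : Fin n → Fin M) :
    letI := A.seedSpace
    Measurable fun ω => A.sample ω y :=
  A.measurable_history y n le_rfl

theorem measurable_classify (A : ActiveClassifier d M n) (ω : A.Seed)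
    (s : Fin n → Cube d × Fin M) : Measurable (A.classify ω s) := by
  let := A.seedSpace
  exact A.classify_measurable.comp
    (measurable_const.prodMk measurable_id : Measurable fun x : Cube d => ((ω, s), x))

theorem measurable_risk (A : ActiveClassifier d M n) (P : Measure (Cube d × Fin M))
    [IsProbabilityMeasure P] (y : Fin n → Fin M) :
    letI := A.seedSpace
    Measurable fun ω => risk P (A.classify ω (A.sample ω y)) := by
  let := A.seedSpace
  have h : Measurable fun q : A.Seed × (Cube d × Fin M) =>
      A.classify q.1 (A.sample q.1 y) q.2.1 :=
    A.classify_measurable.comp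
      ((measurable_fst.prodMk ((A.measurable_sample y).comp measurable_fst)).prodMk
        (measurable_fst.comp measurable_snd))
  have hs : MeasurableSet {q : A.Seed × (Cube d × Fin M) |
      A.classify q.1 (A.sample q.1 y) q.2.1 ≠ q.2.2} :=
    (measurableSet_eq_fun h (measurable_snd.comp measurable_snd)).compl
  exact (measurable_measure_prodMk_left hs).ennreal_toReal

theorem measurable_answerProb (A : ActiveClassifier d M n) {η : Cube d → Fin M → ℝ}
    (hη : ∀ j, Measurable fun x => η x j) (y : Fin n → Fin M) :
    letI := A.seedSpace
    Measurable fun ω => A.answerProb η ω y := by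
  let := A.seedSpace
  refine Finset.measurable_prod _ fun t _ => (hη (y t)).comp ?_
  exact measurable_fst.comp (measurable_pi_iff.1 (A.measurable_sample y) t)

/-- The expected risk is a Bochner integral, hence `0` by default without integrability; averaging
over a family of laws needs the genuine integral. -/
theorem integrable_expectedExcessRisk [M.AtLeastTwo] (A : ActiveClassifier d M n)
    {P : Measure (Cube d × Fin M)} {η : Cube d → Fin M → ℝ} [IsProbabilityMeasure P]
    (hη : IsRegressionFunction P η) :
    letI := A.seedSpace
    Integrable (fun ω => ∑ y : Fin n → Fin M,
      A.answerProb η ω y * excessRisk P η (A.classify ω (A.sample ω y))) A.seedLaw := by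
  let := A.seedSpace
  have := A.seedProb
  refine integrable_finsetSum _ fun y _ => ?_
  have hle : ∀ x j, η x j ≤ 1 := fun x j => by
    rw [← hη.sum_eq_one x]
    exact Finset.single_le_sum (fun i _ => hη.nonneg x i) (Finset.mem_univ j)
  refine Integrable.of_bound (C := 1) ?_ (Filter.Eventually.of_forall fun ω => ?_)
  · exact ((A.measurable_answerProb hη.measurable y).mul
      ((A.measurable_risk P y).sub_const _)).aestronglyMeasurable
  · rw [norm_mul]
    refine mul_le_one₀ ?_ (norm_nonneg _) ?_
    · rw [answerProb, Real.norm_of_nonneg (Finset.prod_nonneg fun _ _ => hη.nonneg _ _)]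
      exact Finset.prod_le_one (fun _ _ => hη.nonneg _ _) fun _ _ => hle _ _
    · rw [Real.norm_eq_abs, excessRisk, risk, risk]
      refine abs_sub_le_iff.2 ⟨?_, ?_⟩ <;>
        linarith [measureReal_nonneg (μ := P)
            (s := {q | A.classify ω (A.sample ω y) q.1 ≠ q.2}),
          measureReal_le_one (μ := P) (s := {q | A.classify ω (A.sample ω y) q.1 ≠ q.2}),
          measureReal_nonneg (μ := P) (s := {q | bayes η q.1 ≠ q.2}),
          measureReal_le_one (μ := P) (s := {q | bayes η q.1 ≠ q.2})]

/-- Averaging over a finite family of laws. -/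
theorem exists_le_expectedExcessRisk [M.AtLeastTwo] (A : ActiveClassifier d M n) {ι : Type*}
    {S : Finset ι} (hS : S.Nonempty) (P : ι → Measure (Cube d × Fin M))
    (η : ι → Cube d → Fin M → ℝ) (hP : ∀ i ∈ S, IsProbabilityMeasure (P i))
    (hη : ∀ i ∈ S, IsRegressionFunction (P i) (η i)) {c : ℝ}
    (hc : ∀ ω, S.card * c ≤ ∑ i ∈ S, ∑ y : Fin n → Fin M,
      A.answerProb (η i) ω y * excessRisk (P i) (η i) (A.classify ω (A.sample ω y))) :
    ∃ i ∈ S, c ≤ A.expectedExcessRisk (P i) (η i) := by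
  let := A.seedSpace
  have := A.seedProb
  refine Finset.exists_le_of_sum_le hS ?_
  rw [Finset.sum_const, nsmul_eq_mul]
  have hint : ∀ i ∈ S, Integrable (fun ω => ∑ y : Fin n → Fin M,
      A.answerProb (η i) ω y * excessRisk (P i) (η i) (A.classify ω (A.sample ω y)))
        A.seedLaw := fun i hi => by
    have := hP i hi
    exact A.integrable_expectedExcessRisk (hη i hi)
  unfold expectedExcessRisk
  rw [← integral_finsetSum _ hint]
  calc S.card * c = ∫ _, (S.card * c : ℝ) ∂A.seedLaw := by simp
    _ ≤ _ := integral_mono (integrable_const _) (integrable_finsetSum _ hint) hc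

end ActiveClassifier

theorem le_minimaxExcessRisk {d M n : ℕ} [M.AtLeastTwo] {ζ : Params} {c : ℝ}
    (h : ∀ A : ActiveClassifier d M n, ∃ (P : Measure (Cube d × Fin M)) (η : Cube d → Fin M → ℝ),
      InClass ζ P η ∧ c ≤ A.expectedExcessRisk P η) :
    (c : EReal) ≤ minimaxExcessRisk d M ζ n := by
  refine le_iInf fun A => ?_
  obtain ⟨P, η, hP, hc⟩ := h A
  exact le_iSup_of_le P (le_iSup_of_le η (le_iSup_of_le hP (EReal.coe_le_coe_iff.2 hc)))

/-! ### Two labels: margins, Bayes rule and excess risk in terms of `f = η₁ - η₀` -/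

section Binary

variable {d : ℕ}

/-- The binary regression function with `η₁ - η₀ = f`. -/
def binaryRegression (f : Cube d → ℝ) (x : Cube d) (y : Fin 2) : ℝ :=
  if y = 1 then (1 + f x) / 2 else (1 - f x) / 2

/-- The law of `(X, Y)` with marginal `μ` and regression function `η`. -/
def jointLaw {M : ℕ} (μ : Measure (Cube d)) (η : Cube d → Fin M → ℝ) : Measure (Cube d × Fin M) :=
  ∑ j, (μ.withDensity fun x => ENNReal.ofReal (η x j)).map fun x => (x, j)

theorem jointLaw_apply {M : ℕ} (μ : Measure (Cube d)) (η : Cube d → Fin M → ℝ)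
    {s : Set (Cube d × Fin M)} (hs : MeasurableSet s) :
    jointLaw μ η s = ∑ j, ∫⁻ x in {x | (x, j) ∈ s}, ENNReal.ofReal (η x j) ∂μ := by
  rw [jointLaw, Measure.finsetSum_apply]
  refine Finset.sum_congr rfl fun j _ => ?_
  rw [Measure.map_apply measurable_prodMk_right hs,
    withDensity_apply _ (measurable_prodMk_right hs)]
  rfl

theorem sum_lintegral_regression {M : ℕ} (μ : Measure (Cube d)) {η : Cube d → Fin M → ℝ}
    (hm : ∀ j, Measurable fun x => η x j) (h0 : ∀ x j, 0 ≤ η x j) (h1 : ∀ x, ∑ j, η x j = 1)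
    (A : Set (Cube d)) :
    ∑ j, ∫⁻ x in A, ENNReal.ofReal (η x j) ∂μ = μ A := by
  rw [← lintegral_finsetSum _ fun j _ => (hm j).ennreal_ofReal]
  simp_rw [← ENNReal.ofReal_sum_of_nonneg fun j _ => h0 _ j, h1]
  simp

theorem fst_jointLaw {M : ℕ} (μ : Measure (Cube d)) {η : Cube d → Fin M → ℝ}
    (hm : ∀ j, Measurable fun x => η x j) (h0 : ∀ x j, 0 ≤ η x j) (h1 : ∀ x, ∑ j, η x j = 1) :
    (jointLaw μ η).fst = μ := by
  ext A hA
  rw [Measure.fst_apply hA, jointLaw_apply _ _ (measurable_fst hA)]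
  exact sum_lintegral_regression μ hm h0 h1 A

theorem isRegressionFunction_jointLaw {M : ℕ} (μ : Measure (Cube d)) {η : Cube d → Fin M → ℝ}
    (hm : ∀ j, Measurable fun x => η x j) (h0 : ∀ x j, 0 ≤ η x j) (h1 : ∀ x, ∑ j, η x j = 1) :
    IsRegressionFunction (jointLaw μ η) η where
  measurable := hm
  nonneg := h0
  sum_eq_one := h1
  version j A hA := by
    rw [fst_jointLaw μ hm h0 h1, jointLaw_apply _ _ (hA.prod (measurableSet_singleton j)),
      Finset.sum_eq_single j]
    · simp
    · intro i _ hij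
      simp [hij]
    · simp

theorem isProbabilityMeasure_jointLaw {M : ℕ} (μ : Measure (Cube d)) [IsProbabilityMeasure μ]
    {η : Cube d → Fin M → ℝ} (hm : ∀ j, Measurable fun x => η x j) (h0 : ∀ x j, 0 ≤ η x j)
    (h1 : ∀ x, ∑ j, η x j = 1) : IsProbabilityMeasure (jointLaw μ η) := by
  constructor
  rw [jointLaw_apply _ _ MeasurableSet.univ]
  simpa using sum_lintegral_regression μ hm h0 h1 Set.univ

variable {f : Cube d → ℝ}

theorem binaryRegression_measurable (hf : Measurable f) (j : Fin 2) :
    Measurable fun x => binaryRegression f x j := by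
  unfold binaryRegression
  split_ifs <;> fun_prop

theorem binaryRegression_nonneg (hf : ∀ x, |f x| ≤ 1) (x : Cube d) (j : Fin 2) :
    0 ≤ binaryRegression f x j := by
  have := abs_le.1 (hf x)
  unfold binaryRegression
  split_ifs <;> linarith

theorem binaryRegression_sum (f : Cube d → ℝ) (x : Cube d) :
    ∑ j, binaryRegression f x j = 1 := by
  simp [Fin.sum_univ_two, binaryRegression]
  ring

theorem binaryRegression_one (x : Cube d) : binaryRegression f x 1 = (1 + f x) / 2 := by
  simp [binaryRegression]

theorem binaryRegression_zero (x : Cube d) : binaryRegression f x 0 = (1 - f x) / 2 := by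
  simp [binaryRegression]

theorem binaryRegression_le (x : Cube d) (y : Fin 2) :
    binaryRegression f x y ≤ (1 + |f x|) / 2 := by
  have h1 := le_abs_self (f x)
  have h2 := neg_abs_le (f x)
  fin_cases y
  · simp only [Fin.zero_eta, binaryRegression_zero]; linarith
  · simp only [Fin.mk_one, binaryRegression_one]; linarith

theorem exists_binaryRegression_eq (x : Cube d) :
    ∃ y, binaryRegression f x y = (1 + |f x|) / 2 := by
  rcases abs_choice (f x) with h | h <;> rw [h]
  · exact ⟨1, binaryRegression_one x⟩
  · exact ⟨0, by rw [binaryRegression_zero]; ring⟩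

theorem iSup_binaryRegression (x : Cube d) :
    ⨆ y, binaryRegression f x y = (1 + |f x|) / 2 := by
  obtain ⟨y, hy⟩ := exists_binaryRegression_eq (f := f) x
  refine le_antisymm (ciSup_le fun y => binaryRegression_le x y) ?_
  rw [← hy]
  exact le_ciSup (Set.finite_range _).bddAbove y

theorem binaryRegression_eq_or (x : Cube d) (y : Fin 2) :
    binaryRegression f x y = (1 + |f x|) / 2 ∨ binaryRegression f x y = (1 - |f x|) / 2 := by
  fin_cases y <;> rcases abs_choice (f x) with h | h <;> rw [h] <;>
    simp [binaryRegression_zero, binaryRegression_one, sub_eq_add_neg]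

theorem labelGap_binaryRegression (x : Cube d) (y : Fin 2) :
    labelGap (binaryRegression f) x y = 0 ∨ labelGap (binaryRegression f) x y = |f x| := by
  rw [labelGap, iSup_binaryRegression]
  rcases binaryRegression_eq_or (f := f) x y with h | h <;> rw [h]
  · left; ring
  · right; ring

/-- A tie leaves no positive gap, so the margin is `⊤` there. Hence cells with `f = 0` cost nothing
in the first margin condition and matter only for `margin'`, where `τ` pays for them. -/
theorem abs_le_of_margin_le {x : Cube d} {ε : ℝ} (h : margin (binaryRegression f) x ≤ ε) :
    f x ≠ 0 ∧ |f x| ≤ ε := by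
  by_cases hf : f x = 0
  · exfalso
    have : margin (binaryRegression f) x = ⊤ := by
      refine le_antisymm le_top (le_iInf₂ fun y hy => ?_)
      rcases labelGap_binaryRegression (f := f) x y with h | h <;> rw [h] at hy
      · exact absurd hy (lt_irrefl _)
      · simp [hf] at hy
    rw [this] at h
    exact EReal.coe_ne_top ε (top_le_iff.1 h)
  · refine ⟨hf, ?_⟩
    have : ((|f x| : ℝ) : EReal) ≤ margin (binaryRegression f) x := by
      refine le_iInf₂ fun y hy => ?_
      rcases labelGap_binaryRegression (f := f) x y with h | h
      · rw [h] at hy; exact absurd hy (lt_irrefl _)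
      · rw [h]
    exact EReal.coe_le_coe_iff.1 (this.trans h)

theorem margin'_binaryRegression (x : Cube d) : margin' (binaryRegression f) x = |f x| := by
  have hmono := Tuple.monotone_sort fun y => -binaryRegression f x y
  have h01 := hmono (show (0 : Fin 2) ≤ 1 by decide)
  simp only [Function.comp] at h01
  have hinj := (Tuple.sort fun y => -binaryRegression f x y).injective.ne
    (show (0 : Fin 2) ≠ 1 by decide)
  rw [margin', decreasing]
  change binaryRegression f x (Tuple.sort (fun y => -binaryRegression f x y) 0) -
    binaryRegression f x (Tuple.sort (fun y => -binaryRegression f x y) 1) = |f x|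
  revert h01 hinj
  generalize Tuple.sort (fun y => -binaryRegression f x y) 0 = a
  generalize Tuple.sort (fun y => -binaryRegression f x y) 1 = b
  intro h01 hinj
  have h : ∀ a b : Fin 2, a ≠ b → (a = 0 ∧ b = 1) ∨ (a = 1 ∧ b = 0) := by decide
  rcases h a b hinj with ⟨rfl, rfl⟩ | ⟨rfl, rfl⟩ <;>
    simp only [binaryRegression_zero, binaryRegression_one] at h01 ⊢
  · rw [abs_of_nonpos (by linarith)]; ring
  · rw [abs_of_nonneg (by linarith)]; ring

theorem binaryRegression_bayes (x : Cube d) :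
    binaryRegression f x (bayes (binaryRegression f) x) = (1 + |f x|) / 2 := by
  have h := Finset.min'_mem _ (argmax_nonempty (binaryRegression f x))
  rw [Finset.mem_filter] at h
  obtain ⟨y, hy⟩ := exists_binaryRegression_eq (f := f) x
  exact le_antisymm (binaryRegression_le _ _) (hy ▸ h.2 y)

theorem bayes_binaryRegression (x : Cube d) :
    bayes (binaryRegression f) x = if 0 < f x then 1 else 0 := by
  have h := binaryRegression_bayes (f := f) x
  split_ifs with hf
  · rw [abs_of_pos hf] at h
    by_contra hb
    have : bayes (binaryRegression f) x = 0 := by omega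
    rw [this, binaryRegression_zero] at h
    linarith
  · push Not at hf
    rcases hf.lt_or_eq with hlt | heq
    · rw [abs_of_neg hlt] at h
      by_contra hb
      have : bayes (binaryRegression f) x = 1 := by omega
      rw [this, binaryRegression_one] at h
      linarith
    · refine le_antisymm (Finset.min'_le _ _ ?_) (Fin.zero_le _)
      rw [Finset.mem_filter]
      refine ⟨Finset.mem_univ _, fun y => (binaryRegression_le x y).trans ?_⟩
      rw [binaryRegression_zero, heq]
      simp

theorem measurable_bayes_binaryRegression (hf : Measurable f) :
    Measurable (bayes (binaryRegression f)) := by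
  have : bayes (binaryRegression f) = fun x => if 0 < f x then 1 else 0 :=
    funext bayes_binaryRegression
  rw [this]
  exact Measurable.ite (measurableSet_lt measurable_const hf) measurable_const measurable_const

theorem measurable_binaryRegression_comp (hf : Measurable f) {g : Cube d → Fin 2}
    (hg : Measurable g) : Measurable fun x => binaryRegression f x (g x) := by
  unfold binaryRegression
  exact Measurable.ite (hg (measurableSet_singleton 1)) (by fun_prop) (by fun_prop)

theorem integrable_binaryRegression_comp {μ : Measure (Cube d)} [IsProbabilityMeasure μ]
    (hf : Measurable f) (hf1 : ∀ x, |f x| ≤ 1) {g : Cube d → Fin 2} (hg : Measurable g) :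
    Integrable (fun x => binaryRegression f x (g x)) μ := by
  refine Integrable.of_bound (C := 1)
    (measurable_binaryRegression_comp hf hg).aestronglyMeasurable
    (Filter.Eventually.of_forall fun x => ?_)
  rw [Real.norm_of_nonneg (binaryRegression_nonneg hf1 _ _)]
  linarith [binaryRegression_le (f := f) x (g x), hf1 x]

theorem risk_jointLaw {μ : Measure (Cube d)} [IsProbabilityMeasure μ] (hf : Measurable f)
    (hf1 : ∀ x, |f x| ≤ 1) {g : Cube d → Fin 2} (hg : Measurable g) :
    risk (jointLaw μ (binaryRegression f)) g = 1 - ∫ x, binaryRegression f x (g x) ∂μ := by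
  have hs : MeasurableSet {q : Cube d × Fin 2 | g q.1 ≠ q.2} :=
    (measurableSet_eq_fun (hg.comp measurable_fst) measurable_snd).compl
  have hsj : ∀ j, MeasurableSet {x | (x, j) ∈ {q : Cube d × Fin 2 | g q.1 ≠ q.2}} :=
    fun j => measurable_prodMk_right hs
  have e : jointLaw μ (binaryRegression f) {q | g q.1 ≠ q.2} =
      ENNReal.ofReal (∫ x, (1 - binaryRegression f x (g x)) ∂μ) := by
    rw [jointLaw_apply _ _ hs, ofReal_integral_eq_lintegral_ofReal]
    · simp_rw [← lintegral_indicator (hsj _)]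
      rw [← lintegral_finsetSum _ fun j _ =>
        (binaryRegression_measurable hf j).ennreal_ofReal.indicator (hsj j)]
      refine lintegral_congr fun x => ?_
      have hsum := binaryRegression_sum f x
      rw [Fin.sum_univ_two] at hsum ⊢
      rcases (show ∀ a : Fin 2, a = 0 ∨ a = 1 by decide) (g x) with h | h <;>
        simp [Set.indicator, h, ← hsum]
    · exact (integrable_const _).sub (integrable_binaryRegression_comp hf hf1 hg)
    · refine Filter.Eventually.of_forall fun x => ?_
      have := binaryRegression_le (f := f) x (g x)
      simp only [Pi.zero_apply]
      linarith [hf1 x]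
  rw [risk, measureReal_def, e, ENNReal.toReal_ofReal,
    integral_sub (integrable_const _) (integrable_binaryRegression_comp hf hf1 hg)]
  · simp
  · refine integral_nonneg fun x => ?_
    have := binaryRegression_le (f := f) x (g x)
    simp only [Pi.zero_apply]
    linarith [hf1 x]

/-- The excess risk is at least the mass of the errors on disjoint sets where the margin is `H`. -/
theorem le_excessRisk {μ : Measure (Cube d)} [IsProbabilityMeasure μ] (hf : Measurable f)
    (hf1 : ∀ x, |f x| ≤ 1) {g : Cube d → Fin 2} (hg : Measurable g) {J : Type*} (T : Finset J)
    {B : J → Set (Cube d)} (hB : ∀ j, MeasurableSet (B j))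
    (hd : ∀ x i j, x ∈ B i → x ∈ B j → i = j) {c : J → Fin 2} {H : ℝ}
    (hfB : ∀ j ∈ T, ∀ x ∈ B j, f x = if c j = 1 then H else -H) :
    ∑ j ∈ T, H * μ.real (B j ∩ {x | g x ≠ c j}) ≤
      excessRisk (jointLaw μ (binaryRegression f)) (binaryRegression f) g := by
  have hb := measurable_bayes_binaryRegression hf
  rw [excessRisk, risk_jointLaw hf hf1 hg, risk_jointLaw hf hf1 hb, sub_sub_sub_cancel_left,
    ← integral_sub (integrable_binaryRegression_comp hf hf1 hb)
      (integrable_binaryRegression_comp hf hf1 hg)]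
  have hm : ∀ j, MeasurableSet (B j ∩ {x | g x ≠ c j}) := fun j =>
    (hB j).inter (hg (measurableSet_singleton (c j))).compl
  have e : ∑ j ∈ T, H * μ.real (B j ∩ {x | g x ≠ c j}) =
      ∫ x, ∑ j ∈ T, (B j ∩ {x | g x ≠ c j}).indicator (fun _ => H) x ∂μ := by
    rw [integral_finsetSum _ fun j _ => (integrable_const H).indicator (hm j)]
    refine Finset.sum_congr rfl fun j _ => ?_
    rw [integral_indicator_const _ (hm j), smul_eq_mul, mul_comm]
  rw [e]
  refine integral_mono (integrable_finsetSum _ fun j _ => (integrable_const H).indicator (hm j))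
    ((integrable_binaryRegression_comp hf hf1 hb).sub
      (integrable_binaryRegression_comp hf hf1 hg)) fun x => ?_
  simp only [binaryRegression_bayes]
  have hnn : 0 ≤ (1 + |f x|) / 2 - binaryRegression f x (g x) :=
    sub_nonneg.2 (binaryRegression_le _ _)
  -- By disjointness at most one indicator is nonzero; a wrong label then costs `|f x|`, which is at
  -- least `H`.
  by_cases hx : ∃ j ∈ T, x ∈ B j ∩ {x | g x ≠ c j}
  · obtain ⟨j, hj, hxj⟩ := hx
    rw [Finset.sum_eq_single_of_mem j hj, Set.indicator_of_mem hxj]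
    · have h1 := hfB j hj x hxj.1
      have h2 : g x ≠ c j := hxj.2
      have h3 := le_abs_self (f x)
      have h4 := neg_abs_le (f x)
      rcases (show ∀ a b : Fin 2, a ≠ b → (a = 0 ∧ b = 1) ∨ (a = 1 ∧ b = 0) by decide) _ _ h2 with
        ⟨h, h'⟩ | ⟨h, h'⟩
      · simp only [h', if_true] at h1
        rw [h, binaryRegression_zero]; linarith
      · simp only [h', zero_ne_one, if_false] at h1
        rw [h, binaryRegression_one]; linarith
    · intro i _ hij
      exact Set.indicator_of_notMem (fun hi => hij (hd x i j hi.1 hxj.1)) _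
  · push Not at hx
    rw [Finset.sum_eq_zero fun j hj => Set.indicator_of_notMem (hx j hj) _]
    exact hnn

theorem holderSmooth_binaryRegression {α L : ℝ}
    (hf : ∀ x z, |f x - f z| ≤ 2 * L * dist x z ^ α) : HolderSmooth (binaryRegression f) α L := by
  intro x z y
  have h := abs_le.1 (hf x z)
  rw [abs_le]
  fin_cases y
  · simp only [Fin.zero_eta, binaryRegression_zero]; constructor <;> linarith
  · simp only [Fin.mk_one, binaryRegression_one]; constructor <;> linarith

end Binary

/-! ### Divergence between nearby binary regression functions -/

section Information

/-- This is `log t ≤ t - 1` at `t = p / q`. The linear term is kept exactly because it cancels in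
the sum over the two labels. -/
theorem le_mul_log_div {p q : ℝ} (hp : 0 < p) (hq : 1 / 4 ≤ q) :
    -(p - q) - 4 * (p - q) ^ 2 ≤ p * Real.log (q / p) := by
  have hq0 : 0 < q := by linarith
  have h1 := Real.log_le_sub_one_of_pos (div_pos hp hq0)
  have h2 : Real.log (q / p) = -Real.log (p / q) := by rw [← Real.log_inv, inv_div]
  have h3 : p * (p / q - 1) = (p - q) + (p - q) ^ 2 / q := by field_simp; ring
  have h4 : (p - q) ^ 2 / q ≤ 4 * (p - q) ^ 2 := by
    rw [div_le_iff₀ hq0]; nlinarith [sq_nonneg (p - q)]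
  rw [h2]
  nlinarith [mul_le_mul_of_nonneg_left h1 hp.le]

variable {d : ℕ}

/-- The log-likelihood ratio of two binary regression functions. -/
def logRatio (f g : Cube d → ℝ) (x : Cube d) (a : Fin 2) : ℝ :=
  -- Where the functions agree no positivity is then needed; the background reaches 1, so a label
  -- may have probability zero there.
  if f x = g x then 0 else Real.log (binaryRegression g x a / binaryRegression f x a)

theorem binaryRegression_pos {f : Cube d → ℝ} {x : Cube d} (hf : |f x| ≤ 1 / 2) (a : Fin 2) :
    1 / 4 ≤ binaryRegression f x a := by
  obtain ⟨h1, h2⟩ := abs_le.1 hf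
  unfold binaryRegression
  split_ifs <;> linarith

theorem binaryRegression_eq_mul_exp {f g : Cube d → ℝ}
    (h : ∀ x, f x ≠ g x → |f x| ≤ 1 / 2 ∧ |g x| ≤ 1 / 2) (x : Cube d) (a : Fin 2) :
    binaryRegression g x a = binaryRegression f x a * Real.exp (logRatio f g x a) := by
  unfold logRatio
  split_ifs with hx
  · simp [binaryRegression, hx]
  · have h1 := binaryRegression_pos (h x hx).1 a
    have h2 := binaryRegression_pos (h x hx).2 a
    have h1' : 0 < binaryRegression f x a := by linarith
    rw [Real.exp_log (div_pos (by linarith) h1')]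
    field_simp

theorem le_sum_mul_logRatio {f g : Cube d → ℝ} {b : Cube d → ℝ} {H : ℝ}
    (hb : ∀ x, 0 ≤ b x)
    (h : ∀ x, f x ≠ g x → |f x| ≤ 1 / 2 ∧ |g x| ≤ 1 / 2 ∧ |f x - g x| ≤ 2 * H ∧ b x = 1)
    (x : Cube d) :
    -(8 * H ^ 2 * b x) ≤ ∑ a, binaryRegression f x a * logRatio f g x a := by
  by_cases hx : f x = g x
  · simp only [logRatio, hx, if_true, mul_zero, Finset.sum_const_zero]
    have := hb x
    simp only [Left.neg_nonpos_iff]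
    positivity
  · obtain ⟨h1, h2, h3, h4⟩ := h x hx
    have k : ∀ a, _ := fun a => le_mul_log_div (lt_of_lt_of_le (by norm_num)
      (binaryRegression_pos h1 a)) (binaryRegression_pos h2 a)
    have k0 := k 0
    have k1 := k 1
    have hsq : (f x - g x) ^ 2 ≤ (2 * H) ^ 2 := sq_le_sq' (abs_le.1 h3).1 (abs_le.1 h3).2
    simp only [Fin.sum_univ_two, logRatio, if_neg hx, h4]
    simp only [binaryRegression_zero, binaryRegression_one] at k0 k1 ⊢
    -- The linear terms of the two labels are opposite; the quadratic ones add up to `2 (f x - g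
    -- x)²`, at most `8 H²`.
    nlinarith

/-- The two point bound for two functions that differ from `f` by at most `2 H`, and only where
`b = 1`. -/
theorem le_sum_lik_binary (π : (t : ℕ) → (Fin t → Cube d × Fin 2) → Cube d)
    {f g₁ g₂ b : Cube d → ℝ} {H : ℝ} (hf : ∀ x, |f x| ≤ 1) (hb : ∀ x, 0 ≤ b x)
    (h₁ : ∀ x, f x ≠ g₁ x → |f x| ≤ 1 / 2 ∧ |g₁ x| ≤ 1 / 2 ∧ |f x - g₁ x| ≤ 2 * H ∧ b x = 1)
    (h₂ : ∀ x, f x ≠ g₂ x → |f x| ≤ 1 / 2 ∧ |g₂ x| ≤ 1 / 2 ∧ |f x - g₂ x| ≤ 2 * H ∧ b x = 1)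
    (n : ℕ) {a : (Fin n → Fin 2) → ℝ} (ha0 : ∀ y, 0 ≤ a y) (ha1 : ∀ y, a y ≤ 1) :
    3 / 4 - 32 * H ^ 2 * visits π (binaryRegression f) b n ≤
      ∑ y, lik π (binaryRegression g₁) n y * (1 - a y) +
        ∑ y, lik π (binaryRegression g₂) n y * a y := by
  have := le_sum_lik_test π (binaryRegression_nonneg hf) (binaryRegression_sum f)
    (binaryRegression_sum g₁) (binaryRegression_sum g₂)
    (binaryRegression_eq_mul_exp fun x hx => ⟨(h₁ x hx).1, (h₁ x hx).2.1⟩)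
    (binaryRegression_eq_mul_exp fun x hx => ⟨(h₂ x hx).1, (h₂ x hx).2.1⟩)
    (le_sum_mul_logRatio hb h₁) (le_sum_mul_logRatio hb h₂) n ha0 ha1
  linarith

end Information

/-! ### The hard regression functions: background and signed bumps -/

section Field

theorem abs_rpow_sub_rpow_le {a b α : ℝ} (ha : 0 ≤ a) (hb : 0 ≤ b) (hα : 0 < α) (hα1 : α ≤ 1) :
    |a ^ α - b ^ α| ≤ |a - b| ^ α := by
  have key : ∀ x y : ℝ, 0 ≤ y → y ≤ x → |x ^ α - y ^ α| ≤ |x - y| ^ α := by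
    intro x y hy hyx
    have h1 := Real.rpow_add_le_add_rpow (sub_nonneg.2 hyx) hy hα.le hα1
    rw [sub_add_cancel] at h1
    rw [abs_of_nonneg (sub_nonneg.2 hyx),
      abs_of_nonneg (sub_nonneg.2 (Real.rpow_le_rpow hy hyx hα.le))]
    linarith
  rcases le_total b a with h | h
  · exact key a b hb h
  · rw [abs_sub_comm, abs_sub_comm a]; exact key b a ha h

variable {d : ℕ}

/-- The coordinates of a point of the cube, as a point of the space with the sup norm. -/
def coords (x : Cube d) : Fin d → ℝ := WithLp.ofLp x.1

/-- Cells and balls are taken in the sup norm, where volumes are explicit; this transfers Hölder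
bounds to the Euclidean distance. -/
theorem dist_coords_le (x z : Cube d) : dist (coords x) (coords z) ≤ dist x z := by
  refine (dist_pi_le_iff dist_nonneg).2 fun i => ?_
  rw [Subtype.dist_eq, dist_eq_norm, dist_eq_norm]
  exact PiLp.norm_apply_le (x.1 - z.1) i

theorem measurable_coords : Measurable (coords (d := d)) :=
  (PiLp.volume_preserving_ofLp (Fin d)).measurable.comp measurable_subtype_coe

theorem coords_nonneg (x : Cube d) (i : Fin d) : 0 ≤ coords x i := (x.2 i).1

/-- The centre of a cell of the grid of mesh `r`. -/
def center (r : ℝ) {K : ℕ} (j : Fin d → Fin K) (i : Fin d) : ℝ := ((j i : ℕ) + 1 / 2) * r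

/-- A bump of height `lam * (r / 4) ^ α`, supported in the cell `j`. -/
def bump (α lam r : ℝ) {K : ℕ} (j : Fin d → Fin K) (x : Cube d) : ℝ :=
  lam * (min (r / 4) (max (r / 2 - dist (coords x) (center r j)) 0)) ^ α

/-- The height of the bumps. -/
def height (α lam r : ℝ) : ℝ := lam * (r / 4) ^ α

/-- A function that vanishes near the origin and is equal to one far from it. -/
def background (α s : ℝ) (x : Cube d) : ℝ :=
  min 1 (2 * (max (‖coords x‖ - s) 0) ^ α)

/-- The background with signed bumps. -/
def field (α lam r : ℝ) {K : ℕ} (σ : (Fin d → Fin K) → SignType) (x : Cube d) : ℝ :=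
  background α (K * r) x + ∑ j, (σ j : ℝ) * bump α lam r j x

variable {α lam r : ℝ} {K : ℕ}

theorem abs_sign_le (s : SignType) : |(s : ℝ)| ≤ 1 := by
  cases s <;> simp

section basic

variable (hα : 0 < α) (hlam : 0 < lam) (hr : 0 < r)
include hα hlam hr

omit hα in
theorem bump_nonneg (j : Fin d → Fin K) (x : Cube d) : 0 ≤ bump α lam r j x :=
  mul_nonneg hlam.le (Real.rpow_nonneg (le_min (by positivity) (le_max_right _ _)) _)

theorem bump_le_height (j : Fin d → Fin K) (x : Cube d) : bump α lam r j x ≤ height α lam r :=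
  mul_le_mul_of_nonneg_left (Real.rpow_le_rpow (le_min (by positivity) (le_max_right _ _))
    (min_le_left _ _) hα.le) hlam.le

omit hlam in
theorem bump_eq_zero {j : Fin d → Fin K} {x : Cube d} (h : r / 2 ≤ dist (coords x) (center r j)) :
    bump α lam r j x = 0 := by
  rw [bump, max_eq_right (by linarith), min_eq_right (by positivity), Real.zero_rpow hα.ne',
    mul_zero]

omit hα hlam in
theorem bump_eq_height {j : Fin d → Fin K} {x : Cube d}
    (h : dist (coords x) (center r j) ≤ r / 4) : bump α lam r j x = height α lam r := by
  rw [bump, max_eq_left (by linarith), min_eq_left (by linarith), height]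

theorem bump_holder (hα1 : α ≤ 1) (j : Fin d → Fin K) (x z : Cube d) :
    |bump α lam r j x - bump α lam r j z| ≤ lam * dist x z ^ α := by
  have h0 : ∀ x : Cube d, 0 ≤ min (r / 4) (max (r / 2 - dist (coords x) (center r j)) 0) :=
    fun x => le_min (by positivity) (le_max_right _ _)
  rw [bump, bump, ← mul_sub, abs_mul, abs_of_pos hlam]
  refine mul_le_mul_of_nonneg_left ((abs_rpow_sub_rpow_le (h0 x) (h0 z) hα hα1).trans ?_) hlam.le
  refine Real.rpow_le_rpow (abs_nonneg _) ?_ hα.le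
  refine (abs_min_sub_min_le_max _ _ _ _).trans ?_
  rw [sub_self, abs_zero]
  refine max_le dist_nonneg ((abs_max_sub_max_le_abs _ _ _).trans ?_)
  rw [sub_sub_sub_cancel_left, abs_sub_comm]
  exact (abs_dist_sub_le _ _ _).trans (dist_coords_le x z)

omit hα hlam in
theorem cell_unique {x : Cube d} {i j : Fin d → Fin K}
    (hi : dist (coords x) (center r i) < r / 2) (hj : dist (coords x) (center r j) < r / 2) :
    i = j := by
  funext l
  have h1 := (dist_le_pi_dist (coords x) (center r i) l).trans_lt hi
  have h2 := (dist_le_pi_dist (coords x) (center r j) l).trans_lt hj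
  rw [Real.dist_eq, abs_lt, center] at h1 h2
  have h3 : ((i l : ℕ) : ℝ) * r < ((j l : ℕ) + 1) * r := by nlinarith
  have h4 : ((j l : ℕ) : ℝ) * r < ((i l : ℕ) + 1) * r := by nlinarith
  have h3' := lt_of_mul_lt_mul_right h3 hr.le
  have h4' := lt_of_mul_lt_mul_right h4 hr.le
  apply Fin.ext
  have h5 : (i l : ℕ) < (j l : ℕ) + 1 := by exact_mod_cast h3'
  have h6 : (j l : ℕ) < (i l : ℕ) + 1 := by exact_mod_cast h4'
  omega

omit hα hlam in
theorem norm_coords_le_of_cell {x : Cube d} {j : Fin d → Fin K}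
    (hj : dist (coords x) (center r j) < r / 2) : ‖coords x‖ ≤ K * r := by
  refine (pi_norm_le_iff_of_nonneg (by positivity)).2 fun l => ?_
  have h1 := (dist_le_pi_dist (coords x) (center r j) l).trans_lt hj
  rw [Real.dist_eq, abs_lt, center] at h1
  rw [Real.norm_of_nonneg (coords_nonneg x l)]
  have h2 : ((j l : ℕ) : ℝ) + 1 ≤ K := by exact_mod_cast (j l).2
  nlinarith [mul_le_mul_of_nonneg_right h2 hr.le]

omit hlam hr in
theorem background_eq_zero {s : ℝ} {x : Cube d} (h : ‖coords x‖ ≤ s) : background α s x = 0 := by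
  rw [background, max_eq_right (by linarith), Real.zero_rpow hα.ne']
  simp

omit hα hlam hr in
theorem background_nonneg (s : ℝ) (x : Cube d) : 0 ≤ background α s x :=
  le_min zero_le_one (mul_nonneg two_pos.le (Real.rpow_nonneg (le_max_right _ _) _))

omit hlam hr in
theorem background_holder (hα1 : α ≤ 1) (s : ℝ) (x z : Cube d) :
    |background α s x - background α s z| ≤ 2 * dist x z ^ α := by
  refine (abs_min_sub_min_le_max _ _ _ _).trans ?_
  rw [sub_self, abs_zero]
  refine max_le (by positivity) ?_
  rw [← mul_sub, abs_mul, abs_two]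
  refine mul_le_mul_of_nonneg_left ?_ two_pos.le
  refine (abs_rpow_sub_rpow_le (le_max_right _ _) (le_max_right _ _) hα hα1).trans ?_
  refine Real.rpow_le_rpow (abs_nonneg _) ((abs_max_sub_max_le_abs _ _ _).trans ?_) hα.le
  rw [sub_sub_sub_cancel_right]
  refine (abs_norm_sub_norm_le _ _).trans ?_
  rw [← dist_eq_norm]
  exact dist_coords_le x z

omit hlam in
theorem field_of_cell (σ : (Fin d → Fin K) → SignType) {x : Cube d} {j : Fin d → Fin K}
    (hj : dist (coords x) (center r j) < r / 2) :
    field α lam r σ x = σ j * bump α lam r j x := by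
  rw [field, background_eq_zero hα (norm_coords_le_of_cell hr hj), zero_add,
    Finset.sum_eq_single_of_mem j (Finset.mem_univ _)]
  intro i _ hij
  rw [bump_eq_zero hα hr (not_lt.1 fun h => hij (cell_unique hr h hj)), mul_zero]

omit hlam in
theorem field_of_not_cell (σ : (Fin d → Fin K) → SignType) {x : Cube d}
    (hj : ∀ j : Fin d → Fin K, r / 2 ≤ dist (coords x) (center r j)) :
    field α lam r σ x = background α (K * r) x := by
  rw [field, Finset.sum_eq_zero, add_zero]
  intro i _
  rw [bump_eq_zero hα hr (hj i), mul_zero]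

theorem abs_field_of_cell (σ : (Fin d → Fin K) → SignType) {x : Cube d} {j : Fin d → Fin K}
    (hj : dist (coords x) (center r j) < r / 2) : |field α lam r σ x| ≤ height α lam r := by
  rw [field_of_cell hα hr σ hj, abs_mul, abs_of_nonneg (bump_nonneg hlam hr j x)]
  exact (mul_le_of_le_one_left (bump_nonneg hlam hr j x) (abs_sign_le _)).trans
    (bump_le_height hα hlam hr j x)

theorem abs_field_le_one (hH : height α lam r ≤ 1) (σ : (Fin d → Fin K) → SignType) (x : Cube d) :
    |field α lam r σ x| ≤ 1 := by
  by_cases h : ∃ j : Fin d → Fin K, dist (coords x) (center r j) < r / 2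
  · obtain ⟨j, hj⟩ := h
    exact (abs_field_of_cell hα hlam hr σ hj).trans hH
  · push Not at h
    rw [field_of_not_cell hα hr σ h, abs_of_nonneg (background_nonneg _ _)]
    exact min_le_left _ _

/-- Each point lies in at most one open cell, so between `x` and `z` at most two bumps change,
however many cells there are. They contribute `2 * lam`, the background `2`. -/
theorem field_holder (hα1 : α ≤ 1) (σ : (Fin d → Fin K) → SignType) (x z : Cube d) :
    |field α lam r σ x - field α lam r σ z| ≤ 2 * (1 + lam) * dist x z ^ α := by
  classical
  have hsum : |∑ j, (σ j : ℝ) * bump α lam r j x - ∑ j, (σ j : ℝ) * bump α lam r j z| ≤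
      2 * (lam * dist x z ^ α) := by
    rw [← Finset.sum_sub_distrib]
    refine (Finset.abs_sum_le_sum_abs _ _).trans ?_
    set c : Cube d → Finset (Fin d → Fin K) := fun x =>
      Finset.univ.filter fun j => dist (coords x) (center r j) < r / 2
    have hc : ∀ x, (c x).card ≤ 1 := fun x => Finset.card_le_one.2 fun i hi j hj =>
      cell_unique hr (Finset.mem_filter.1 hi).2 (Finset.mem_filter.1 hj).2
    have hzero : ∀ j ∈ Finset.univ, j ∉ c x ∪ c z →
        |(σ j : ℝ) * bump α lam r j x - (σ j : ℝ) * bump α lam r j z| = 0 := by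
      intro j _ hj
      simp only [c, Finset.mem_union, Finset.mem_filter, Finset.mem_univ, true_and, not_or,
        not_lt] at hj
      rw [bump_eq_zero hα hr hj.1, bump_eq_zero hα hr hj.2]
      simp
    rw [← Finset.sum_subset (Finset.subset_univ (c x ∪ c z)) hzero]
    have hcard : ((c x ∪ c z).card : ℝ) ≤ 2 := by
      exact_mod_cast (Finset.card_union_le _ _).trans (Nat.add_le_add (hc x) (hc z))
    refine (Finset.sum_le_card_nsmul _ _ (lam * dist x z ^ α) fun j _ => ?_).trans ?_
    · rw [← mul_sub, abs_mul]
      exact (mul_le_of_le_one_left (abs_nonneg _) (abs_sign_le _)).trans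
        (bump_holder hα hlam hr hα1 j x z)
    · rw [nsmul_eq_mul]
      exact mul_le_mul_of_nonneg_right hcard (by positivity)
  have hbg := background_holder hα hα1 (K * r) x z
  rw [field, field, add_sub_add_comm]
  refine (abs_add_le _ _).trans ((add_le_add hbg hsum).trans (le_of_eq ?_))
  ring

/-- One sign affects only its own cell, where both functions are at most `1 / 2` in absolute value;
the label probabilities there stay above `1 / 4`, as the divergence bound requires. -/
theorem field_update (hH : height α lam r ≤ 1 / 2) (σ : (Fin d → Fin K) → SignType)
    (j : Fin d → Fin K) (s : SignType) (x : Cube d)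
    (hne : field α lam r σ x ≠ field α lam r (Function.update σ j s) x) :
    |field α lam r σ x| ≤ 1 / 2 ∧ |field α lam r (Function.update σ j s) x| ≤ 1 / 2 ∧
      |field α lam r σ x - field α lam r (Function.update σ j s) x| ≤ 2 * height α lam r ∧
      dist (coords x) (center r j) < r / 2 := by
  have hcell : dist (coords x) (center r j) < r / 2 := by
    by_contra hj
    apply hne
    by_cases h : ∃ i : Fin d → Fin K, dist (coords x) (center r i) < r / 2
    · obtain ⟨i, hi⟩ := h
      rw [field_of_cell hα hr _ hi, field_of_cell hα hr _ hi,
        Function.update_of_ne (show i ≠ j from fun h => hj (h ▸ hi))]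
    · push Not at h
      rw [field_of_not_cell hα hr _ h, field_of_not_cell hα hr _ h]
  have h1 := abs_field_of_cell hα hlam hr σ hcell
  have h2 := abs_field_of_cell hα hlam hr (Function.update σ j s) hcell
  refine ⟨h1.trans hH, h2.trans hH, (abs_sub _ _).trans (by linarith), hcell⟩

end basic

theorem measurable_field (σ : (Fin d → Fin K) → SignType) : Measurable (field α lam r σ) := by
  have hn : Measurable fun x : Cube d => ‖coords x‖ := measurable_coords.norm
  have hd : ∀ j : Fin d → Fin K, Measurable fun x : Cube d => dist (coords x) (center r j) :=
    fun j => measurable_coords.dist measurable_const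
  unfold field background bump
  fun_prop

end Field

/-! ### The marginal and the choice of constants -/

section Design

variable {d : ℕ}

theorem measurableSet_cube (d : ℕ) : MeasurableSet (cube d) := by
  have : cube d = ⋂ i, {x : EuclideanSpace ℝ (Fin d) | x i ∈ Set.Icc (0 : ℝ) 1} := by
    ext x; simp [cube]
  rw [this]
  refine MeasurableSet.iInter fun i => ?_
  exact (measurable_pi_apply i).comp (PiLp.volume_preserving_ofLp (Fin d)).measurable
    measurableSet_Icc

theorem lebesgue_preimage_coords {A : Set (Fin d → ℝ)} (hA : MeasurableSet A) :
    lebesgue d (coords ⁻¹' A) = volume (A ∩ Set.Icc 0 1) := by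
  rw [lebesgue, (MeasurableEmbedding.subtype_coe (measurableSet_cube d)).comap_apply,
    ← (PiLp.volume_preserving_ofLp (Fin d)).measure_preimage
      (hA.inter measurableSet_Icc).nullMeasurableSet]
  congr 1
  ext x
  constructor
  · rintro ⟨y, hy, rfl⟩
    exact ⟨hy, fun i => (y.2 i).1, fun i => (y.2 i).2⟩
  · rintro ⟨h1, h2, h3⟩
    exact ⟨⟨x, fun i => ⟨h2 i, h3 i⟩⟩, h1, rfl⟩

instance isProbabilityMeasure_lebesgue : IsProbabilityMeasure (lebesgue d) := by
  constructor
  have := lebesgue_preimage_coords (d := d) MeasurableSet.univ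
  rw [Set.preimage_univ, Set.univ_inter, Real.volume_Icc_pi] at this
  simpa using this

theorem lebesgue_norm_coords_le {t : ℝ} (ht : 0 ≤ t) :
    lebesgue d {x | ‖coords x‖ ≤ t} ≤ ENNReal.ofReal (t ^ d) := by
  have h : {x : Cube d | ‖coords x‖ ≤ t} = coords ⁻¹' Metric.closedBall 0 t := by
    ext x; simp
  rw [h, lebesgue_preimage_coords Metric.isClosed_closedBall.measurableSet]
  have hsub : Metric.closedBall (0 : Fin d → ℝ) t ∩ Set.Icc 0 1 ⊆ Set.Icc 0 (fun _ => t) := by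
    rintro y ⟨h1, h2, -⟩
    rw [mem_closedBall_zero_iff, pi_norm_le_iff_of_nonneg ht] at h1
    exact ⟨h2, fun i => (le_abs_self _).trans (h1 i)⟩
  refine (measure_mono hsub).trans ?_
  rw [Real.volume_Icc_pi]
  simp [ENNReal.ofReal_pow ht]

/-- The ball on which the bump of the cell `j` is constant, up to the factor `rho`. -/
def cellBall (rho r : ℝ) {K : ℕ} (j : Fin d → Fin K) : Set (Cube d) :=
  coords ⁻¹' Metric.closedBall (center r j) (rho * r)

theorem measurableSet_cellBall (rho r : ℝ) {K : ℕ} (j : Fin d → Fin K) :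
    MeasurableSet (cellBall rho r j) :=
  measurable_coords Metric.isClosed_closedBall.measurableSet

theorem lebesgue_cellBall {rho r : ℝ} {K : ℕ} (hr : 0 < r) (hrho : 0 ≤ rho) (hrho2 : rho ≤ 1 / 4)
    (hK : K * r ≤ 1) (j : Fin d → Fin K) :
    lebesgue d (cellBall rho r j) = ENNReal.ofReal ((2 * (rho * r)) ^ d) := by
  rw [cellBall, lebesgue_preimage_coords Metric.isClosed_closedBall.measurableSet,
    Set.inter_eq_left.2, Real.volume_pi_closedBall _ (by positivity), Fintype.card_fin]
  intro y hy
  rw [Metric.mem_closedBall, dist_pi_le_iff (by positivity)] at hy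
  have h : ∀ i, 0 ≤ y i ∧ y i ≤ 1 := by
    intro i
    have h1 := hy i
    rw [Real.dist_eq, abs_le, center] at h1
    have h2 : ((j i : ℕ) : ℝ) + 1 ≤ K := by exact_mod_cast (j i).2
    have h3 := mul_le_mul_of_nonneg_right h2 hr.le
    have h4 : 0 ≤ ((j i : ℕ) : ℝ) * r := by positivity
    have h5 := mul_le_mul_of_nonneg_right hrho2 hr.le
    constructor <;> nlinarith
  exact ⟨fun i => (h i).1, fun i => (h i).2⟩

/-- The support of the marginal: balls in the cells, and the points far from the cells. -/
def supportSet (d : ℕ) (rho r : ℝ) (K : ℕ) : Set (Cube d) :=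
  (⋃ j : Fin d → Fin K, cellBall rho r j) ∪ {x | 2 * (K * r) < ‖coords x‖}

theorem measurableSet_supportSet (rho r : ℝ) (K : ℕ) : MeasurableSet (supportSet d rho r K) :=
  (MeasurableSet.iUnion fun j => measurableSet_cellBall rho r j).union
    (measurableSet_lt measurable_const measurable_coords.norm)

/-- The value of the density of the marginal on its support. -/
def densityValue (d : ℕ) (rho r : ℝ) (K : ℕ) : ℝ := ((lebesgue d).real (supportSet d rho r K))⁻¹

/-- The uniform law on the support. -/
def marginal (d : ℕ) (rho r : ℝ) (K : ℕ) : Measure (Cube d) :=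
  (lebesgue d).withDensity fun x =>
    ENNReal.ofReal ((supportSet d rho r K).indicator (fun _ => densityValue d rho r K) x)

theorem marginal_apply (rho r : ℝ) (K : ℕ) {A : Set (Cube d)} (hA : MeasurableSet A) :
    marginal d rho r K A =
      ENNReal.ofReal (densityValue d rho r K) * lebesgue d (A ∩ supportSet d rho r K) := by
  have e : (fun x => ENNReal.ofReal
      ((supportSet d rho r K).indicator (fun _ => densityValue d rho r K) x)) =
      (supportSet d rho r K).indicator fun _ => ENNReal.ofReal (densityValue d rho r K) := by
    ext x
    by_cases hx : x ∈ supportSet d rho r K <;> simp [hx]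
  rw [marginal, withDensity_apply _ hA, e, lintegral_indicator (measurableSet_supportSet rho r K),
    setLIntegral_const, Measure.restrict_apply (measurableSet_supportSet rho r K), Set.inter_comm]

theorem marginal_apply_le (rho r : ℝ) (K : ℕ) {A : Set (Cube d)} (hA : MeasurableSet A) :
    marginal d rho r K A ≤ ENNReal.ofReal (densityValue d rho r K) * lebesgue d A := by
  rw [marginal_apply _ _ _ hA]
  gcongr
  exact Set.inter_subset_left

theorem marginal_compl_supportSet (rho r : ℝ) (K : ℕ) :
    marginal d rho r K (supportSet d rho r K)ᶜ = 0 := by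
  rw [marginal_apply _ _ _ (measurableSet_supportSet rho r K).compl]
  simp

theorem marginal_cellBall {rho r : ℝ} {K : ℕ} (hr : 0 < r) (hrho : 0 ≤ rho) (hrho2 : rho ≤ 1 / 4)
    (hK : K * r ≤ 1) (j : Fin d → Fin K) :
    marginal d rho r K (cellBall rho r j) =
      ENNReal.ofReal (densityValue d rho r K * (2 * (rho * r)) ^ d) := by
  rw [marginal_apply _ _ _ (measurableSet_cellBall _ _ _), Set.inter_eq_left.2,
    lebesgue_cellBall hr hrho hrho2 hK,
    ENNReal.ofReal_mul (show 0 ≤ densityValue d rho r K from inv_nonneg.2 measureReal_nonneg)]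
  exact fun x hx => Or.inl (Set.mem_iUnion.2 ⟨j, hx⟩)

theorem le_lebesgue_supportSet {rho r : ℝ} {K : ℕ} (hr : 0 < r) :
    1 - (2 * (K * r)) ^ d ≤ (lebesgue d).real (supportSet d rho r K) := by
  have h0 : 0 ≤ 2 * (K * r) := by positivity
  have h1 : (lebesgue d).real {x : Cube d | ‖coords x‖ ≤ 2 * (K * r)} ≤ (2 * (K * r)) ^ d := by
    rw [measureReal_def]
    exact ENNReal.toReal_le_of_le_ofReal (by positivity) (lebesgue_norm_coords_le h0)
  have hm : MeasurableSet {x : Cube d | ‖coords x‖ ≤ 2 * (K * r)} :=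
    measurableSet_le measurable_coords.norm measurable_const
  have h2 := probReal_compl_eq_one_sub (μ := lebesgue d) hm
  have h3 : (lebesgue d).real {x : Cube d | ‖coords x‖ ≤ 2 * (K * r)}ᶜ ≤
      (lebesgue d).real (supportSet d rho r K) :=
    measureReal_mono fun x hx => Or.inr (by simpa using hx)
  linarith

/-- Constants for the construction of hard laws. -/
structure Constants (d : ℕ) (α L β C μmax : ℝ) where
  lam : ℝ
  rho : ℝ
  side : ℝ
  dens : ℝ
  lam_pos : 0 < lam
  lam_le_half : lam ≤ 1 / 2
  lam_le : 1 + lam ≤ L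
  rho_pos : 0 < rho
  rho_le : rho ≤ 1 / 4
  side_pos : 0 < side
  side_le : side ≤ 1 / 2
  dens_le : dens ≤ μmax
  one_le_dens : 1 ≤ dens
  volume_le : 1 ≤ dens * (1 - (2 * side) ^ d)
  mass_le : dens * (2 * rho) ^ d ≤ 1
  margin_le : dens * (1 + (2 * rho) ^ d * (4 ^ α / lam) ^ β) ≤ C

/-- The slack in the three strict inequalities is spent as follows: `L > 1` on the bumps, `μmax > 1`
and half of `C - 1` on a density slightly above 1, which fixes the volume the corner may lose, and
the other half of `C - 1` on the active balls, by making `rho` small. -/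
theorem exists_constants {α L β C μmax : ℝ} (hd : d ≠ 0) (hL : 1 < L) (hC : 1 < C)
    (hμ : 1 < μmax) : Nonempty (Constants d α L β C μmax) := by
  set lam := min (L - 1) (1 / 2)
  have hlam : 0 < lam := lt_min (by linarith) (by norm_num)
  set p := min μmax ((1 + C) / 2)
  have hp : 1 < p := lt_min hμ (by linarith)
  have hpC : p ≤ (1 + C) / 2 := min_le_right _ _
  have hp0 : 0 < p := by linarith
  have hpi : p⁻¹ < 1 := inv_lt_one_of_one_lt₀ hp
  have hpi0 : 0 < p⁻¹ := inv_pos.2 hp0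
  set q := (4 ^ α / lam) ^ β
  have hq : 0 < q := by positivity
  -- `v` is twice `rho`; its three bounds serve `rho_le`, `mass_le` and `margin_le`.
  set v := min (1 / 2) (min (1 / p) ((C - 1) / 2 / (p * q)))
  have hv : 0 < v := lt_min (by norm_num) (lt_min (by positivity)
    (div_pos (by linarith) (by positivity)))
  have hv1 : v ≤ 1 / 2 := min_le_left _ _
  have hv2 : v ≤ 1 / p := (min_le_right _ _).trans (min_le_left _ _)
  have hv3 : v ≤ (C - 1) / 2 / (p * q) := (min_le_right _ _).trans (min_le_right _ _)
  have hvd : (2 * (v / 2)) ^ d ≤ v := by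
    rw [mul_div_cancel₀ _ two_ne_zero]
    exact pow_le_of_le_one hv.le (by linarith) hd
  refine ⟨⟨lam, v / 2, (1 - p⁻¹) / 2, p, hlam, min_le_right _ _, ?_, by linarith, by linarith,
    by linarith, by linarith, min_le_left _ _, hp.le, ?_, ?_, ?_⟩⟩
  · have : lam ≤ L - 1 := min_le_left _ _
    linarith
  · have : (2 * ((1 - p⁻¹) / 2)) ^ d ≤ 1 - p⁻¹ := by
      rw [mul_div_cancel₀ _ two_ne_zero]
      exact pow_le_of_le_one (by linarith) (by linarith) hd
    have h2 : p * p⁻¹ ≤ p * (1 - (2 * ((1 - p⁻¹) / 2)) ^ d) :=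
      mul_le_mul_of_nonneg_left (by linarith) hp0.le
    rwa [mul_inv_cancel₀ hp0.ne'] at h2
  · rw [le_div_iff₀ hp0] at hv2
    nlinarith
  · rw [le_div_iff₀ (by positivity)] at hv3
    have : p * (2 * (v / 2)) ^ d * q ≤ v * (p * q) := by
      nlinarith [mul_le_mul_of_nonneg_right hvd (mul_nonneg hp0.le hq.le)]
    change p * (1 + (2 * (v / 2)) ^ d * q) ≤ C
    linarith

/-! ### Membership of the hard laws in the class -/

section Class

variable {α L β C μmax r : ℝ} {K : ℕ} (c : Constants d α L β C μmax)
  (hα : 0 < α) (hα1 : α < 1) (hβ : 0 < β) (hr : 0 < r) (hK : K * r ≤ c.side)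
include hr hK

/-- The cube has volume one, so normalizing on a subset gives a density of at least 1, above every
admissible `μmin`. The upper bound holds because the far part of the support alone has volume at
least `1 - (2 * side)^d`. -/
theorem one_le_densityValue_and : 1 ≤ densityValue d c.rho r K ∧
    densityValue d c.rho r K ≤ c.dens ∧
      0 < (lebesgue d).real (supportSet d c.rho r K) := by
  have h1 := le_lebesgue_supportSet (d := d) (rho := c.rho) (K := K) hr
  have h2 : (2 * (K * r)) ^ d ≤ (2 * c.side) ^ d :=
    pow_le_pow_left₀ (by positivity) (by linarith) d
  have h3 := c.volume_le
  have hd0 : 0 < c.dens := by linarith [c.one_le_dens]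
  have h4 : 1 ≤ c.dens * (lebesgue d).real (supportSet d c.rho r K) :=
    h3.trans (mul_le_mul_of_nonneg_left (by linarith) hd0.le)
  have h5 : 0 < (lebesgue d).real (supportSet d c.rho r K) := by
    by_contra h
    nlinarith
  refine ⟨(one_le_inv₀ h5).2 measureReal_le_one, ?_, h5⟩
  rw [densityValue, inv_le_iff_one_le_mul₀ h5]
  exact h4

theorem isProbabilityMeasure_marginal : IsProbabilityMeasure (marginal d c.rho r K) := by
  obtain ⟨h1, -, h2⟩ := one_le_densityValue_and c hr hK
  constructor
  rw [marginal_apply _ _ _ MeasurableSet.univ, Set.univ_inter, ← ofReal_measureReal,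
    ← ENNReal.ofReal_mul (by linarith), densityValue, inv_mul_cancel₀ h2.ne', ENNReal.ofReal_one]

theorem strongDensity_marginal {μmin : ℝ} (hμ : μmin ≤ 1) :
    StrongDensity (marginal d c.rho r K) μmin μmax := by
  obtain ⟨h1, h2, -⟩ := one_le_densityValue_and c hr hK
  refine ⟨(supportSet d c.rho r K).indicator fun _ => densityValue d c.rho r K,
    measurable_const.indicator (measurableSet_supportSet _ _ _),
    fun x => Set.indicator_nonneg (fun _ _ => by linarith) x, rfl, fun x hx => ?_⟩
  by_cases hxS : x ∈ supportSet d c.rho r K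
  · rw [Set.indicator_of_mem hxS]
    exact ⟨by linarith, h2.trans c.dens_le⟩
  · simp [Set.indicator_of_notMem hxS] at hx

theorem marginal_iUnion_cellBall_le (T : Finset (Fin d → Fin K)) {m : ℝ}
    (hm : (T.card : ℝ) * r ^ d * (c.dens * (2 * c.rho) ^ d) ≤ m) :
    marginal d c.rho r K (⋃ j ∈ T, cellBall c.rho r j) ≤ ENNReal.ofReal m := by
  obtain ⟨h1, h2, -⟩ := one_le_densityValue_and c hr hK
  have hK1 : K * r ≤ 1 := by linarith [c.side_le]
  refine (measure_biUnion_finset_le _ _).trans ?_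
  rw [Finset.sum_congr rfl fun j _ => marginal_cellBall hr c.rho_pos.le c.rho_le hK1 j,
    Finset.sum_const, nsmul_eq_mul, ← ENNReal.ofReal_natCast, ← ENNReal.ofReal_mul (by positivity)]
  refine ENNReal.ofReal_le_ofReal (le_trans ?_ hm)
  have e : (2 * (c.rho * r)) ^ d = r ^ d * (2 * c.rho) ^ d := by rw [← mul_pow]; ring
  rw [e]
  have h5 : 0 ≤ (T.card : ℝ) * r ^ d * (2 * c.rho) ^ d := by
    have := c.rho_pos.le
    positivity
  nlinarith [mul_le_mul_of_nonneg_right h2 h5]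

omit hK in
include hα hα1 in
-- The support leaves a gap between radii `K r` and `2 K r`: beyond it the distance to the corner is
-- at least half the norm, and the factor 2 in the background absorbs `2 ^ α`.
theorem cube_le_of_background_le {ε : ℝ} (hε1 : ε < 1) {x : Cube d}
    (hx : 2 * (K * r) < ‖coords x‖) (hb : background α (K * r) x ≤ ε) :
    ‖coords x‖ ≤ ε ^ (1 / α) := by
  have hs : 0 ≤ K * r := by positivity
  have h1 : 2 * (max (‖coords x‖ - K * r) 0) ^ α ≤ ε := by
    rw [background, min_le_iff] at hb
    exact hb.resolve_left (by linarith)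
  rw [max_eq_left (by linarith)] at h1
  have h2 : ‖coords x‖ / 2 ≤ ‖coords x‖ - K * r := by linarith
  have h3 : (‖coords x‖ / 2) ^ α ≤ (‖coords x‖ - K * r) ^ α :=
    Real.rpow_le_rpow (by positivity) h2 hα.le
  have h4 : ‖coords x‖ ^ α ≤ ε := by
    rw [Real.div_rpow (norm_nonneg _) two_pos.le, div_le_iff₀ (by positivity)] at h3
    have h5 : (2 : ℝ) ^ α ≤ 2 := by
      simpa using Real.rpow_le_rpow_of_exponent_le one_le_two hα1.le
    have h6 : 0 ≤ (‖coords x‖ - K * r) ^ α := Real.rpow_nonneg (by linarith) _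
    nlinarith
  calc ‖coords x‖ = (‖coords x‖ ^ α) ^ (1 / α) := by
        rw [← Real.rpow_mul (norm_nonneg _), mul_one_div_cancel hα.ne', Real.rpow_one]
    _ ≤ ε ^ (1 / α) := Real.rpow_le_rpow (by positivity) h4 (by positivity)

omit hK in
theorem height_bounds (hα : 0 < α) (hr1 : r ≤ 1) :
    0 < height α c.lam r ∧ height α c.lam r ≤ 1 / 2 ∧
      height α c.lam r ^ 2 ≤ r ^ (2 * α) / 4 := by
  have h0 := c.lam_pos
  have h1 : (r / 4) ^ α ≤ r ^ α := Real.rpow_le_rpow (by positivity) (by linarith) hα.le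
  have h2 : r ^ α ≤ 1 := Real.rpow_le_one hr.le hr1 hα.le
  have h3 : 0 < (r / 4) ^ α := by positivity
  have h4 : height α c.lam r ≤ r ^ α / 2 := by
    rw [height]; nlinarith [c.lam_le_half]
  have h5 : 0 < height α c.lam r := by rw [height]; positivity
  refine ⟨h5, by linarith, ?_⟩
  have h6 : r ^ (2 * α) = (r ^ α) ^ 2 := by
    rw [mul_comm, Real.rpow_mul hr.le, Real.rpow_two]
  rw [h6]
  nlinarith

omit hK in
theorem mem_cell_of_mem_cellBall {x : Cube d} {j : Fin d → Fin K} (hx : x ∈ cellBall c.rho r j) :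
    dist (coords x) (center r j) ≤ r / 4 := by
  have h1 : dist (coords x) (center r j) ≤ c.rho * r := hx
  nlinarith [c.rho_le]

omit hK in
include hα in
theorem field_of_mem_cellBall (σ : (Fin d → Fin K) → SignType) {x : Cube d} {j : Fin d → Fin K}
    (hx : x ∈ cellBall c.rho r j) : field α c.lam r σ x = σ j * height α c.lam r := by
  have h := mem_cell_of_mem_cellBall c hr hx
  rw [field_of_cell hα hr σ (j := j) (by linarith), bump_eq_height hr h]

omit hK in
include hα hα1 in
-- On the support the function is `0` or `±H` on the balls, and the background elsewhere. The second
-- set records that the function vanishes, so that the first margin condition can discard it.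
theorem small_field_subset (σ : (Fin d → Fin K) → SignType) {ε : ℝ} (hε1 : ε < 1) :
    {x : Cube d | |field α c.lam r σ x| ≤ ε} ⊆
      (supportSet d c.rho r K)ᶜ ∪
        {x | field α c.lam r σ x = 0 ∧
          x ∈ ⋃ j ∈ Finset.univ.filter (fun j => σ j = 0), cellBall c.rho r j} ∪
        {x | height α c.lam r ≤ ε ∧
          x ∈ ⋃ j ∈ Finset.univ.filter (fun j => σ j ≠ 0), cellBall c.rho r j} ∪
        {x | ‖coords x‖ ≤ ε ^ (1 / α)} := by
  intro x hx
  by_cases hxS : x ∈ supportSet d c.rho r K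
  · rcases hxS with hx1 | hx2
    · obtain ⟨j, hj⟩ := Set.mem_iUnion.1 hx1
      have hf := field_of_mem_cellBall c hα hr σ hj
      by_cases hσ : σ j = 0
      · refine Or.inl (Or.inl (Or.inr ⟨by rw [hf, hσ]; simp, ?_⟩))
        exact Set.mem_biUnion (Finset.mem_coe.2 (Finset.mem_filter.2 ⟨Finset.mem_univ _, hσ⟩)) hj
      · refine Or.inl (Or.inr ⟨?_, ?_⟩)
        · have hh : 0 ≤ height α c.lam r := by
            have := c.lam_pos
            rw [height]; positivity
          have h1 : |field α c.lam r σ x| ≤ ε := hx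
          rw [hf, abs_mul, abs_of_nonneg hh] at h1
          have : |((σ j : SignType) : ℝ)| = 1 := by
            revert hσ
            cases σ j <;> simp
          rwa [this, one_mul] at h1
        · exact Set.mem_biUnion
            (Finset.mem_coe.2 (Finset.mem_filter.2 ⟨Finset.mem_univ _, hσ⟩)) hj
    · refine Or.inr (cube_le_of_background_le hα hα1 hr hε1 hx2 ?_)
      have hx2' : 2 * (K * r) < ‖coords x‖ := hx2
      have hs : 0 ≤ K * r := by positivity
      rw [← field_of_not_cell hα hr σ fun j => ?_]
      · exact (le_abs_self _).trans hx
      · by_contra h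
        linarith [norm_coords_le_of_cell hr (not_le.1 h)]
  · exact Or.inl (Or.inl (Or.inl hxS))

include hα hα1 hβ in
/-- The margin conditions, where the cells of the hard law without a bump have mass at most `τ`. -/
theorem marginal_small_field_le (hαβ : α * β ≤ d) (σ : (Fin d → Fin K) → SignType)
    (hact : ((Finset.univ.filter fun j => σ j ≠ 0).card : ℝ) * r ^ d ≤ r ^ (α * β)) {τ : ℝ}
    (hτ : 0 ≤ τ) (hnull : ((Finset.univ.filter fun j => σ j = 0).card : ℝ) * r ^ d ≤ τ) {ε : ℝ}
    (hε : 0 < ε) :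
    marginal d c.rho r K {x | field α c.lam r σ x ≠ 0 ∧ |field α c.lam r σ x| ≤ ε} ≤
        ENNReal.ofReal (C * ε ^ β) ∧
      marginal d c.rho r K {x | |field α c.lam r σ x| ≤ ε} ≤ ENNReal.ofReal (τ + C * ε ^ β) := by
  have := isProbabilityMeasure_marginal c hr hK
  obtain ⟨hp1, hp2, -⟩ := one_le_densityValue_and c hr hK
  have hlam := c.lam_pos
  have hrho := c.rho_pos
  have hdens := c.one_le_dens
  have hC1 : 1 ≤ C := by
    refine le_trans ?_ c.margin_le
    have : 0 ≤ (2 * c.rho) ^ d * (4 ^ α / c.lam) ^ β := by positivity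
    nlinarith
  -- For `ε ≥ 1` both bounds exceed one, since `C ≥ 1`.
  rcases le_or_gt 1 ε with hε1 | hε1
  · have h1 : 1 ≤ ε ^ β := Real.one_le_rpow hε1 hβ.le
    have h2 : 1 ≤ C * ε ^ β := by nlinarith
    exact ⟨prob_le_one.trans (ENNReal.one_le_ofReal.2 h2),
      prob_le_one.trans (ENNReal.one_le_ofReal.2 (by linarith))⟩
  set μ := marginal d c.rho r K
  have hnullm : μ (⋃ j ∈ Finset.univ.filter (fun j => σ j = 0), cellBall c.rho r j) ≤
      ENNReal.ofReal τ := by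
    refine marginal_iUnion_cellBall_le c hr hK _ ?_
    have h0 := c.mass_le
    have h1 : 0 ≤ c.dens * (2 * c.rho) ^ d := by positivity
    nlinarith
  have hactm : μ {x | height α c.lam r ≤ ε ∧
      x ∈ ⋃ j ∈ Finset.univ.filter (fun j => σ j ≠ 0), cellBall c.rho r j} ≤
        ENNReal.ofReal (c.dens * ((2 * c.rho) ^ d * (4 ^ α / c.lam) ^ β) * ε ^ β) := by
    by_cases hh : height α c.lam r ≤ ε
    · simp only [hh, true_and, Set.ofPred_mem_eq]
      refine marginal_iUnion_cellBall_le c hr hK _ ?_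
      -- The allowed active volume `r ^ (α * β)` is a constant times `H ^ β`, hence at most that
      -- constant times `ε ^ β` once `H ≤ ε`.
      have e : r ^ (α * β) = (4 ^ α / c.lam) ^ β * height α c.lam r ^ β := by
        rw [height, ← Real.mul_rpow (by positivity) (by positivity), Real.div_rpow hr.le (by norm_num),
          Real.rpow_mul hr.le]
        congr 1
        field_simp
      have h2 : height α c.lam r ^ β ≤ ε ^ β :=
        Real.rpow_le_rpow (by rw [height]; positivity) hh hβ.le
      have h3 : r ^ (α * β) ≤ (4 ^ α / c.lam) ^ β * ε ^ β := by
        rw [e]; exact mul_le_mul_of_nonneg_left h2 (by positivity)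
      have h4 : 0 ≤ c.dens * (2 * c.rho) ^ d := by positivity
      calc _ ≤ ((4 ^ α / c.lam) ^ β * ε ^ β) * (c.dens * (2 * c.rho) ^ d) :=
            mul_le_mul_of_nonneg_right (hact.trans h3) h4
        _ = _ := by ring
    · simp [hh]
  have hcub : μ {x | ‖coords x‖ ≤ ε ^ (1 / α)} ≤ ENNReal.ofReal (c.dens * ε ^ β) := by
    have hm : MeasurableSet {x : Cube d | ‖coords x‖ ≤ ε ^ (1 / α)} :=
      measurableSet_le measurable_coords.norm measurable_const
    refine (marginal_apply_le _ _ _ hm).trans ?_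
    have ht : 0 ≤ ε ^ (1 / α) := by positivity
    -- This is where `α β ≤ d` enters, with `ε < 1`.
    have h1 : (ε ^ (1 / α)) ^ d ≤ ε ^ β := by
      rw [← Real.rpow_natCast, ← Real.rpow_mul hε.le]
      refine Real.rpow_le_rpow_of_exponent_ge hε hε1.le ?_
      rw [one_div, inv_mul_eq_div, le_div_iff₀ hα]
      linarith
    rw [ENNReal.ofReal_mul (by linarith)]
    exact mul_le_mul' (ENNReal.ofReal_le_ofReal hp2)
      ((lebesgue_norm_coords_le ht).trans (ENNReal.ofReal_le_ofReal h1))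
  have hsum : ENNReal.ofReal (c.dens * ((2 * c.rho) ^ d * (4 ^ α / c.lam) ^ β) * ε ^ β) +
      ENNReal.ofReal (c.dens * ε ^ β) ≤ ENNReal.ofReal (C * ε ^ β) := by
    rw [← ENNReal.ofReal_add (by positivity) (by positivity)]
    refine ENNReal.ofReal_le_ofReal ?_
    have := mul_le_mul_of_nonneg_right c.margin_le (show 0 ≤ ε ^ β by positivity)
    linarith
  have hS := marginal_compl_supportSet (d := d) c.rho r K
  have hsub := small_field_subset c hα hα1 hr σ hε1
  constructor
  · refine (measure_mono (t := (supportSet d c.rho r K)ᶜ ∪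
        {x | height α c.lam r ≤ ε ∧
          x ∈ ⋃ j ∈ Finset.univ.filter (fun j => σ j ≠ 0), cellBall c.rho r j} ∪
        {x | ‖coords x‖ ≤ ε ^ (1 / α)}) ?_).trans ?_
    · rintro x ⟨hx0, hx⟩
      rcases hsub hx with ((h | h) | h) | h
      · exact Or.inl (Or.inl h)
      · exact absurd h.1 hx0
      · exact Or.inl (Or.inr h)
      · exact Or.inr h
    · refine (measure_union_le _ _).trans (le_trans (add_le_add ?_ hcub) hsum)
      refine (measure_union_le _ _).trans ?_
      rw [hS, zero_add]
      exact hactm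
  · refine (measure_mono hsub).trans ((measure_union_le _ _).trans ?_)
    rw [ENNReal.ofReal_add hτ (by positivity)]
    refine le_trans (add_le_add ?_ hcub) (le_trans (le_of_eq (add_assoc _ _ _))
      (add_le_add le_rfl hsum))
    refine (measure_union_le _ _).trans (add_le_add ?_ hactm)
    refine (measure_union_le _ _).trans ?_
    rw [hS, zero_add]
    exact (measure_mono fun x hx => hx.2).trans hnullm

include hα hα1 hβ in
theorem inClass_field (hαβ : α * β ≤ d) (σ : (Fin d → Fin K) → SignType)
    (hr1 : r ≤ 1)
    (hact : ((Finset.univ.filter fun j => σ j ≠ 0).card : ℝ) * r ^ d ≤ r ^ (α * β)) {τ : ℝ}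
    (hτ : 0 ≤ τ) (hnull : ((Finset.univ.filter fun j => σ j = 0).card : ℝ) * r ^ d ≤ τ)
    {Cβ Cβ' μmin : ℝ} (hCβ : C ≤ Cβ) (hCβ' : C ≤ Cβ') (hμ : μmin ≤ 1) :
    InClass ⟨α, L, β, Cβ, Cβ', τ, μmin, μmax⟩
      (jointLaw (marginal d c.rho r K) (binaryRegression (field α c.lam r σ)))
      (binaryRegression (field α c.lam r σ)) := by
  have := isProbabilityMeasure_marginal c hr hK
  obtain ⟨-, hH, -⟩ := height_bounds c hr hα hr1
  have hf1 := abs_field_le_one hα c.lam_pos hr (hH.trans (by norm_num)) σ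
  have hm := binaryRegression_measurable (measurable_field (α := α) (lam := c.lam) (r := r) σ)
  have h0 := binaryRegression_nonneg hf1
  have h1 := binaryRegression_sum (field α c.lam r σ)
  have hfst := fst_jointLaw (marginal d c.rho r K) hm h0 h1
  refine ⟨isProbabilityMeasure_jointLaw _ hm h0 h1, isRegressionFunction_jointLaw _ hm h0 h1,
    holderSmooth_binaryRegression fun x z => ?_, fun ε hε => ?_, ?_⟩
  · refine (field_holder hα c.lam_pos hr hα1.le σ x z).trans ?_
    have := c.lam_le
    have h2 : 0 ≤ dist x z ^ α := by positivity
    exact mul_le_mul_of_nonneg_right (by simpa using this) h2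
  · rw [hfst]
    obtain ⟨g1, g2⟩ := marginal_small_field_le c hα hα1 hβ hr hK hαβ σ hact hτ hnull hε
    have h2 : 0 ≤ ε ^ β := by positivity
    constructor
    · refine (measure_mono fun x hx => abs_le_of_margin_le hx).trans (g1.trans ?_)
      exact ENNReal.ofReal_le_ofReal (mul_le_mul_of_nonneg_right hCβ h2)
    · simp only [margin'_binaryRegression]
      refine g2.trans (ENNReal.ofReal_le_ofReal ?_)
      have := mul_le_mul_of_nonneg_right hCβ' h2
      simpa using this
  · rw [hfst]
    exact strongDensity_marginal c hr hK hμ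

end Class

end Design

/-! ### Averaging over sign vectors -/

section Averaging

variable {J : Type*} [Fintype J] [DecidableEq J]

/-- The coordinates where a sign vector does not vanish. -/
def signSupport (σ : J → SignType) : Finset J := Finset.univ.filter fun j => σ j ≠ 0

omit [DecidableEq J] in
theorem mem_signSupport {σ : J → SignType} {j : J} : j ∈ signSupport σ ↔ σ j ≠ 0 := by
  simp [signSupport]

theorem card_signSupport_update {σ : J → SignType} {j : J} (hj : σ j = 0) {s : SignType}
    (hs : s ≠ 0) : (signSupport (Function.update σ j s)).card = (signSupport σ).card + 1 := by
  have : signSupport (Function.update σ j s) = insert j (signSupport σ) := by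
    ext i
    rw [Finset.mem_insert, mem_signSupport, mem_signSupport]
    by_cases h : i = j
    · subst h; simp [hs]
    · simp [h]
  rw [this, Finset.card_insert_of_notMem (by simp [mem_signSupport, hj])]

/-- The sign vectors without zeros. -/
def fullSigns (J : Type*) [Fintype J] [DecidableEq J] : Finset (J → SignType) :=
  Finset.univ.filter fun σ => ∀ j, σ j ≠ 0

/-- The sign vectors with `k` nonzero entries. -/
def sparseSigns (J : Type*) [Fintype J] [DecidableEq J] (k : ℕ) : Finset (J → SignType) :=
  Finset.univ.filter fun σ => (signSupport σ).card = k

theorem sparseSigns_nonempty {k : ℕ} (hk : k ≤ Fintype.card J) : (sparseSigns J k).Nonempty := by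
  obtain ⟨t, -, ht⟩ := Finset.exists_subset_card_eq (s := (Finset.univ : Finset J)) (n := k) hk
  refine ⟨fun j => if j ∈ t then 1 else 0, ?_⟩
  have : signSupport (fun j => if j ∈ t then (1 : SignType) else 0) = t := by
    ext j; simp [mem_signSupport]
  simp [sparseSigns, this, ht]

/-- The two updates of a full vector are the vector itself and its flip at `j`, and flipping is an
involution. -/
theorem sum_fullSigns_update (G : (J → SignType) → ℝ) (j : J) :
    ∑ σ ∈ fullSigns J, (G (Function.update σ j 1) + G (Function.update σ j (-1))) =
      2 * ∑ σ ∈ fullSigns J, G σ := by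
  have h1 : ∑ σ ∈ fullSigns J, G (Function.update σ j (-σ j)) = ∑ σ ∈ fullSigns J, G σ := by
    have hmem : ∀ σ ∈ fullSigns J, Function.update σ j (-σ j) ∈ fullSigns J := by
      intro σ hσ
      simp only [fullSigns, Finset.mem_filter, Finset.mem_univ, true_and] at hσ ⊢
      intro i
      by_cases h : i = j
      · subst h
        have := hσ i
        revert this
        simp only [Function.update_self]
        cases σ i <;> decide
      · simpa [h] using hσ i
    have hinv : ∀ σ ∈ fullSigns J,
        Function.update (Function.update σ j (-σ j)) j (-Function.update σ j (-σ j) j) = σ := by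
      intro σ _
      simp
    exact Finset.sum_nbij' _ _ hmem hmem hinv hinv fun _ _ => rfl
  rw [two_mul]
  nth_rewrite 2 [← h1]
  rw [← Finset.sum_add_distrib]
  refine Finset.sum_congr rfl fun σ hσ => ?_
  have hj : σ j ≠ 0 := (Finset.mem_filter.1 hσ).2 j
  rcases SignType.trichotomy (σ j) with h | h | h
  · rw [h, neg_neg, ← h, Function.update_eq_self, add_comm]
  · exact absurd h hj
  · rw [h, ← h, Function.update_eq_self]

theorem sum_sparseSigns_update_eq (G : (J → SignType) → ℝ) (j : J) (k : ℕ) {s : SignType}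
    (hs : s ≠ 0) :
    ∑ σ ∈ (sparseSigns J k).filter (fun σ => σ j = 0), G (Function.update σ j s) =
      ∑ σ ∈ (sparseSigns J (k + 1)).filter (fun σ => σ j = s), G σ := by
  refine Finset.sum_nbij' (fun σ => Function.update σ j s) (fun σ => Function.update σ j 0)
    ?_ ?_ ?_ ?_ fun _ _ => rfl
  · intro σ hσ
    simp only [sparseSigns, Finset.mem_filter, Finset.mem_univ, true_and] at hσ ⊢
    exact ⟨by rw [card_signSupport_update hσ.2 hs, hσ.1], by simp⟩
  · intro σ hσ
    simp only [sparseSigns, Finset.mem_filter, Finset.mem_univ, true_and] at hσ ⊢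
    have h := card_signSupport_update (σ := Function.update σ j 0) (j := j) (by simp) hs
    rw [Function.update_idem, ← hσ.2, Function.update_eq_self, hσ.1] at h
    exact ⟨by omega, by simp⟩
  · intro σ hσ
    have := (Finset.mem_filter.1 hσ).2
    simp only [Function.update_idem]
    rw [← this, Function.update_eq_self]
  · intro σ hσ
    have := (Finset.mem_filter.1 hσ).2
    simp only [Function.update_idem]
    rw [← this, Function.update_eq_self]

/-- Double counting: adding a signed entry at a zero coordinate, and erasing a nonzero entry, are
inverse to each other. -/
theorem sum_sparseSigns_update (G : (J → SignType) → J → ℝ) (k : ℕ) :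
    ∑ σ ∈ sparseSigns J k, ∑ j ∈ Finset.univ.filter (fun j => σ j = 0),
        (G (Function.update σ j 1) j + G (Function.update σ j (-1)) j) =
      ∑ σ ∈ sparseSigns J (k + 1), ∑ j ∈ signSupport σ, G σ j := by
  simp only [signSupport, Finset.sum_filter]
  rw [Finset.sum_comm, Finset.sum_comm (s := sparseSigns J (k + 1))]
  refine Finset.sum_congr rfl fun j _ => ?_
  have e : ∀ σ : J → SignType, (if σ j ≠ 0 then G σ j else 0) =
      (if σ j = 1 then G σ j else 0) + if σ j = -1 then G σ j else 0 := by
    intro σ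
    rcases SignType.trichotomy (σ j) with h | h | h <;> simp [h]
  rw [Finset.sum_congr rfl fun σ _ => e σ, Finset.sum_add_distrib, ← Finset.sum_filter,
    ← Finset.sum_filter, ← Finset.sum_filter,
    ← sum_sparseSigns_update_eq (fun σ => G σ j) j k (s := 1) (by decide),
    ← sum_sparseSigns_update_eq (fun σ => G σ j) j k (s := -1) (by decide),
    Finset.sum_add_distrib]

variable {R : (J → SignType) → ℝ} {F V : (J → SignType) → J → ℝ} {c κ N : ℝ}

/-- The budget takes at most half of the number of cells away from three quarters of it; the
remaining quarter is halved because each loss occurs in two pairs. -/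
theorem card_mul_le_sum_fullSigns (hF : ∀ σ, ∑ j ∈ signSupport σ, F σ j ≤ R σ)
    (hpair : ∀ σ j, c * (3 / 4 - κ * V σ j) ≤
      F (Function.update σ j 1) j + F (Function.update σ j (-1)) j)
    (hV : ∀ σ, ∑ j, V σ j ≤ N) (hc : 0 ≤ c) (hκ : 0 ≤ κ) (hN : κ * N ≤ Fintype.card J / 2) :
    (fullSigns J).card * (c * Fintype.card J / 8) ≤ ∑ σ ∈ fullSigns J, R σ := by
  have h1 : ∑ σ ∈ fullSigns J, ∑ j, F σ j ≤ ∑ σ ∈ fullSigns J, R σ := by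
    refine Finset.sum_le_sum fun σ hσ => ?_
    have : signSupport σ = Finset.univ := by
      ext j; simpa [mem_signSupport] using (Finset.mem_filter.1 hσ).2 j
    rw [← this]
    exact hF σ
  have h2 : 2 * ∑ σ ∈ fullSigns J, ∑ j, F σ j = ∑ σ ∈ fullSigns J, ∑ j,
      (F (Function.update σ j 1) j + F (Function.update σ j (-1)) j) := by
    rw [Finset.sum_comm, Finset.mul_sum, Finset.sum_comm (s := fullSigns J)]
    exact Finset.sum_congr rfl fun j _ => (sum_fullSigns_update (fun σ => F σ j) j).symm
  have h3 : ∀ σ ∈ fullSigns J, c * Fintype.card J / 4 ≤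
      ∑ j, (F (Function.update σ j 1) j + F (Function.update σ j (-1)) j) := by
    intro σ _
    refine le_trans ?_ (Finset.sum_le_sum fun j _ => hpair σ j)
    rw [← Finset.mul_sum, Finset.sum_sub_distrib, ← Finset.mul_sum, Finset.sum_const,
      Finset.card_univ, nsmul_eq_mul]
    have := mul_le_mul_of_nonneg_left (hV σ) hκ
    rw [mul_div_assoc]
    exact mul_le_mul_of_nonneg_left (by linarith) hc
  have h4 := Finset.sum_le_sum h3
  rw [Finset.sum_const, nsmul_eq_mul] at h4
  linarith

/-- The reference has `k` bumps and the next one may sit at any zero cell. There are at least `|J| /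
2` of these, while the visits cost only `|J| / 8`, so most candidates remain untested. -/
theorem card_mul_le_sum_sparseSigns (hF : ∀ σ, ∑ j ∈ signSupport σ, F σ j ≤ R σ)
    (hpair : ∀ σ j, c * (3 / 4 - κ * V σ j) ≤
      F (Function.update σ j 1) j + F (Function.update σ j (-1)) j)
    (hV0 : ∀ σ j, 0 ≤ V σ j) (hV : ∀ σ, ∑ j, V σ j ≤ N) (hc : 0 ≤ c) (hκ : 0 ≤ κ) {k : ℕ}
    (hk : 2 * (k + 1) ≤ Fintype.card J) (hN : κ * N ≤ Fintype.card J / 8) :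
    (sparseSigns J (k + 1)).card * (c * (k + 1 : ℕ) / 4) ≤ ∑ σ ∈ sparseSigns J (k + 1), R σ := by
  have hnull : ∀ σ ∈ sparseSigns J k,
      ((Finset.univ.filter fun j => σ j = 0).card : ℝ) = Fintype.card J - k := by
    intro σ hσ
    have h := Finset.card_filter_add_card_filter_not (s := (Finset.univ : Finset J))
      (fun j => σ j = 0)
    have h' : (Finset.univ.filter fun j => ¬ σ j = 0).card = k := (Finset.mem_filter.1 hσ).2
    rw [h', Finset.card_univ] at h
    rw [← h]; push_cast; ring
  have h1 : ∑ σ ∈ sparseSigns J (k + 1), ∑ j ∈ signSupport σ, F σ j ≤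
      ∑ σ ∈ sparseSigns J (k + 1), R σ := Finset.sum_le_sum fun σ _ => hF σ
  rw [← sum_sparseSigns_update] at h1
  -- For the constant function the double counting reads `|S_k| · 2 (|J| - k) = |S_{k+1}| (k + 1)`,
  -- where `S_k` are the vectors with `k` nonzero entries; it converts the average over `S_k` into
  -- one over `S_{k+1}`.
  have hcount := sum_sparseSigns_update (J := J) (fun _ _ => 1) k
  simp only [Finset.sum_const, nsmul_eq_mul, mul_one] at hcount
  rw [Finset.sum_congr rfl fun σ hσ => by rw [hnull σ hσ], Finset.sum_const, nsmul_eq_mul,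
    Finset.sum_congr (g := fun _ => ((k + 1 : ℕ) : ℝ)) rfl fun σ hσ => by
      rw [(Finset.mem_filter.1 hσ).2], Finset.sum_const, nsmul_eq_mul] at hcount
  have hk' : (2 : ℝ) * (k + 1) ≤ Fintype.card J := by exact_mod_cast hk
  have h3 : ∀ σ ∈ sparseSigns J k, c * ((Fintype.card J - k) / 2) ≤
      ∑ j ∈ Finset.univ.filter (fun j => σ j = 0),
        (F (Function.update σ j 1) j + F (Function.update σ j (-1)) j) := by
    intro σ hσ
    refine le_trans ?_ (Finset.sum_le_sum fun j _ => hpair σ j)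
    rw [← Finset.mul_sum, Finset.sum_sub_distrib, ← Finset.mul_sum, Finset.sum_const,
      nsmul_eq_mul, hnull σ hσ]
    have hle : ∑ j ∈ Finset.univ.filter (fun j => σ j = 0), V σ j ≤ N :=
      (Finset.sum_le_sum_of_subset_of_nonneg (Finset.subset_univ _) fun j _ _ => hV0 σ j).trans
        (hV σ)
    have := mul_le_mul_of_nonneg_left hle hκ
    exact mul_le_mul_of_nonneg_left (by linarith) hc
  have h4 := Finset.sum_le_sum h3
  rw [Finset.sum_const, nsmul_eq_mul] at h4
  have h5 : ((sparseSigns J (k + 1)).card : ℝ) * (c * (k + 1 : ℕ) / 4) =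
      (sparseSigns J k).card * (c * ((Fintype.card J - k) / 2)) := by
    linear_combination (-c / 4) * hcount
  linarith

end Averaging

/-! ### Minimax lower bounds at a fixed scale -/

section LowerBounds

variable {d n : ℕ} {α L β C μmax r : ℝ} {K : ℕ} (c : Constants d α L β C μmax)

/-- The indicator of the interior of the cell `j`. -/
def cellIndicator (r : ℝ) {K : ℕ} (j : Fin d → Fin K) (x : Cube d) : ℝ :=
  if dist (coords x) (center r j) < r / 2 then 1 else 0

theorem cellIndicator_nonneg (r : ℝ) {K : ℕ} (j : Fin d → Fin K) (x : Cube d) :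
    0 ≤ cellIndicator r j x := by
  rw [cellIndicator]; split_ifs <;> norm_num

/-- The expected loss of a fixed query rule on the cell `j`, under the bumps `σ`. -/
def cellLoss (c : Constants d α L β C μmax) (r : ℝ) {K : ℕ}
    (π : (t : ℕ) → (Fin t → Cube d × Fin 2) → Cube d)
    (g : (Fin n → Fin 2) → Cube d → Fin 2) (σ : (Fin d → Fin K) → SignType)
    (j : Fin d → Fin K) : ℝ :=
  ∑ y, lik π (binaryRegression (field α c.lam r σ)) n y * (height α c.lam r *
    (marginal d c.rho r K).real (cellBall c.rho r j ∩ {x | g y x ≠ if σ j = 1 then 1 else 0}))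

variable (hα : 0 < α) (hr : 0 < r) (hK : K * r ≤ c.side) (hr1 : r ≤ 1)
include hα hr hK hr1

theorem sum_cellLoss_le (π : (t : ℕ) → (Fin t → Cube d × Fin 2) → Cube d)
    {g : (Fin n → Fin 2) → Cube d → Fin 2} (hg : ∀ y, Measurable (g y))
    (σ : (Fin d → Fin K) → SignType) :
    ∑ j ∈ signSupport σ, cellLoss c r π g σ j ≤
      ∑ y, lik π (binaryRegression (field α c.lam r σ)) n y *
        excessRisk (jointLaw (marginal d c.rho r K) (binaryRegression (field α c.lam r σ)))
          (binaryRegression (field α c.lam r σ)) (g y) := by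
  have := isProbabilityMeasure_marginal c hr hK
  obtain ⟨-, hH, -⟩ := height_bounds c hr hα hr1
  have hf1 := abs_field_le_one hα c.lam_pos hr (hH.trans (by norm_num)) σ
  unfold cellLoss
  rw [Finset.sum_comm]
  refine Finset.sum_le_sum fun y _ => ?_
  rw [← Finset.mul_sum]
  refine mul_le_mul_of_nonneg_left ?_ (lik_nonneg π (binaryRegression_nonneg hf1) n y)
  refine le_excessRisk (measurable_field σ) hf1 (hg y) _
    (fun j => measurableSet_cellBall c.rho r j) (fun x i j hi hj => ?_) fun j hj x hx => ?_
  · have h1 := mem_cell_of_mem_cellBall c hr hi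
    have h2 := mem_cell_of_mem_cellBall c hr hj
    exact cell_unique (x := x) hr (by linarith) (by linarith)
  · rw [field_of_mem_cellBall c hα hr σ hx]
    rw [mem_signSupport] at hj
    rcases SignType.trichotomy (σ j) with h | h | h
    · simp [h, show (-1 : SignType) ≠ 1 by decide]
    · exact absurd h hj
    · simp [h]

/-- On the ball of a cell the classifier acts as a randomized test of the sign: the share of the
mass where it does not answer 0. Its two losses are the two errors of this test, times `H` and the
mass of the ball. -/
theorem le_cellLoss_add_cellLoss (π : (t : ℕ) → (Fin t → Cube d × Fin 2) → Cube d)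
    {g : (Fin n → Fin 2) → Cube d → Fin 2} (hg : ∀ y, Measurable (g y))
    (σ : (Fin d → Fin K) → SignType) (j : Fin d → Fin K) :
    height α c.lam r * (2 * c.rho * r) ^ d * (3 / 4 - 32 * height α c.lam r ^ 2 *
        visits π (binaryRegression (field α c.lam r σ))
          (cellIndicator r j) n) ≤
      cellLoss c r π g (Function.update σ j 1) j +
        cellLoss c r π g (Function.update σ j (-1)) j := by
  have := isProbabilityMeasure_marginal c hr hK
  obtain ⟨hH0, hH, -⟩ := height_bounds c hr hα hr1
  obtain ⟨hp, -⟩ := one_le_densityValue_and c hr hK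
  have hrho := c.rho_pos
  set μ := marginal d c.rho r K with hμ
  set H := height α c.lam r
  set w := μ.real (cellBall c.rho r j) with hw
  have hwv : w = densityValue d c.rho r K * (2 * (c.rho * r)) ^ d := by
    rw [hw, measureReal_def, hμ, marginal_cellBall hr c.rho_pos.le c.rho_le
      (by linarith [c.side_le]), ENNReal.toReal_ofReal (by positivity)]
  have hwle : (2 * c.rho * r) ^ d ≤ w := by
    rw [hwv, ← mul_assoc]
    exact le_mul_of_one_le_left (by positivity) hp
  have hw0 : 0 < w := lt_of_lt_of_le (by positivity) hwle
  set e : (Fin n → Fin 2) → Fin 2 → ℝ := fun y l => μ.real (cellBall c.rho r j ∩ {x | g y x ≠ l})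
    with he
  have hsum : ∀ y, e y 1 + e y 0 = w := by
    intro y
    have hm : MeasurableSet {x | g y x ≠ 1} := (hg y (measurableSet_singleton 1)).compl
    have hc : cellBall c.rho r j \ {x | g y x ≠ 1} = cellBall c.rho r j ∩ {x | g y x ≠ 0} := by
      ext x
      have : ∀ a : Fin 2, ¬ (a ≠ 1) ↔ a ≠ 0 := by decide
      simp only [Set.mem_sdiff, Set.mem_inter_iff, Set.mem_ofPred_eq, this]
    have := measureReal_inter_add_sdiff (μ := μ) (s := cellBall c.rho r j) hm
    rw [hc] at this
    exact this
  have he0 : ∀ y l, 0 ≤ e y l := fun y l => measureReal_nonneg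
  set b : Cube d → ℝ := cellIndicator r j
  have hupd : ∀ s, ∀ x, field α c.lam r σ x ≠ field α c.lam r (Function.update σ j s) x →
      |field α c.lam r σ x| ≤ 1 / 2 ∧ |field α c.lam r (Function.update σ j s) x| ≤ 1 / 2 ∧
        |field α c.lam r σ x - field α c.lam r (Function.update σ j s) x| ≤ 2 * H ∧ b x = 1 := by
    intro s x hx
    obtain ⟨h1, h2, h3, h4⟩ := field_update hα c.lam_pos hr hH σ j s x hx
    exact ⟨h1, h2, h3, if_pos h4⟩
  have htest := le_sum_lik_binary π
    (abs_field_le_one hα c.lam_pos hr (hH.trans (by norm_num)) σ)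
    (cellIndicator_nonneg r j) (hupd 1) (hupd (-1)) n
    (a := fun y => e y 0 / w) (fun y => div_nonneg (he0 y 0) hw0.le)
    (fun y => (div_le_one hw0).2 (by linarith [hsum y, he0 y 1]))
  have e1 : cellLoss c r π g (Function.update σ j 1) j = H * w * ∑ y,
      lik π (binaryRegression (field α c.lam r (Function.update σ j 1))) n y *
        (1 - e y 0 / w) := by
    rw [cellLoss, Finset.mul_sum]
    refine Finset.sum_congr rfl fun y _ => ?_
    rw [Function.update_self, if_pos rfl]
    change _ * (H * e y 1) = _
    rw [show e y 1 = w - e y 0 by linarith [hsum y]]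
    field_simp
  have e2 : cellLoss c r π g (Function.update σ j (-1)) j = H * w * ∑ y,
      lik π (binaryRegression (field α c.lam r (Function.update σ j (-1)))) n y *
        (e y 0 / w) := by
    rw [cellLoss, Finset.mul_sum]
    refine Finset.sum_congr rfl fun y _ => ?_
    rw [Function.update_self, if_neg (by decide)]
    change _ * (H * e y 0) = _
    field_simp
  have hnn : 0 ≤ cellLoss c r π g (Function.update σ j 1) j +
      cellLoss c r π g (Function.update σ j (-1)) j := by
    refine add_nonneg ?_ ?_ <;>
    · refine Finset.sum_nonneg fun y _ => mul_nonneg (lik_nonneg π (binaryRegression_nonneg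
        (abs_field_le_one hα c.lam_pos hr (hH.trans (by norm_num)) _)) n y)
          (mul_nonneg hH0.le measureReal_nonneg)
  -- The mass may be replaced by its lower bound only when this factor is nonnegative; otherwise
  -- nonnegativity of the losses is enough.
  rcases le_total (3 / 4 - 32 * H ^ 2 * visits π (binaryRegression (field α c.lam r σ)) b n) 0
    with h | h
  · exact (mul_nonpos_of_nonneg_of_nonpos (by positivity) h).trans hnn
  · rw [e1, e2, ← mul_add]
    exact mul_le_mul (mul_le_mul_of_nonneg_left hwle hH0.le) htest h (by positivity)

omit hK in
theorem sum_visits_cell_le (π : (t : ℕ) → (Fin t → Cube d × Fin 2) → Cube d)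
    (σ : (Fin d → Fin K) → SignType) :
    ∑ j : Fin d → Fin K, visits π (binaryRegression (field α c.lam r σ))
      (cellIndicator r j) n ≤ n := by
  obtain ⟨-, hH, -⟩ := height_bounds c hr hα hr1
  refine sum_visits_le π (binaryRegression_nonneg
    (abs_field_le_one hα c.lam_pos hr (hH.trans (by norm_num)) σ)) (binaryRegression_sum _)
    (fun x => ?_) n
  by_cases h : ∃ j : Fin d → Fin K, dist (coords x) (center r j) < r / 2
  · obtain ⟨j, hj⟩ := h
    rw [Finset.sum_eq_single_of_mem j (Finset.mem_univ _)]
    · rw [cellIndicator]; split_ifs <;> norm_num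
    · intro i _ hij
      exact if_neg fun hi => hij (cell_unique hr hi hj)
  · push Not at h
    simp only [cellIndicator]
    rw [Finset.sum_eq_zero fun j _ => if_neg (not_lt.2 (h j))]
    exact zero_le_one

/-- From a bound of the averaged loss over a family of sign vectors to the minimax risk. -/
theorem le_minimaxExcessRisk_of_signs (hα1 : α < 1) (hβ : 0 < β) (hαβ : α * β ≤ d)
    {Cβ Cβ' τ μmin : ℝ} (hCβ : C ≤ Cβ) (hCβ' : C ≤ Cβ') (hμ : μmin ≤ 1) (hτ : 0 ≤ τ)
    {S : Finset ((Fin d → Fin K) → SignType)} (hS : S.Nonempty)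
    (hact : ∀ σ ∈ S, ((signSupport σ).card : ℝ) * r ^ d ≤ r ^ (α * β))
    (hnull : ∀ σ ∈ S, ((Finset.univ.filter fun j => σ j = 0).card : ℝ) * r ^ d ≤ τ) {v : ℝ}
    (havg : ∀ (R : ((Fin d → Fin K) → SignType) → ℝ)
      (F V : ((Fin d → Fin K) → SignType) → (Fin d → Fin K) → ℝ),
      (∀ σ, ∑ j ∈ signSupport σ, F σ j ≤ R σ) →
      (∀ σ j, height α c.lam r * (2 * c.rho * r) ^ d *
          (3 / 4 - 32 * height α c.lam r ^ 2 * V σ j) ≤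
        F (Function.update σ j 1) j + F (Function.update σ j (-1)) j) →
      (∀ σ j, 0 ≤ V σ j) → (∀ σ, ∑ j, V σ j ≤ n) → S.card * v ≤ ∑ σ ∈ S, R σ) :
    (v : EReal) ≤ minimaxExcessRisk d 2 ⟨α, L, β, Cβ, Cβ', τ, μmin, μmax⟩ n := by
  have hprob := isProbabilityMeasure_marginal c hr hK
  obtain ⟨-, hH, -⟩ := height_bounds c hr hα hr1
  have hf1 := fun σ : (Fin d → Fin K) → SignType =>
    abs_field_le_one hα c.lam_pos hr (hH.trans (by norm_num)) σ
  refine le_minimaxExcessRisk fun A => ?_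
  have hclass := fun σ hσ => inClass_field c hα hα1 hβ hr hK hαβ σ hr1 (hact σ hσ) hτ
    (hnull σ hσ) hCβ hCβ' hμ
  obtain ⟨σ, hσ, hv⟩ := A.exists_le_expectedExcessRisk hS
    (fun σ => jointLaw (marginal d c.rho r K) (binaryRegression (field α c.lam r σ)))
    (fun σ => binaryRegression (field α c.lam r σ)) (fun σ hσ => (hclass σ hσ).prob)
    (fun σ hσ => (hclass σ hσ).regression) (c := v) (fun ω => by
      -- With the seed fixed, the learner is a deterministic query rule.
      simp only [A.answerProb_eq_lik]
      have hg : ∀ y, Measurable (A.classify ω (A.sample ω y)) :=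
        fun y => A.measurable_classify ω _
      refine havg _ (cellLoss c r (A.policy ω) fun y => A.classify ω (A.sample ω y))
        (fun σ j => visits (A.policy ω) (binaryRegression (field α c.lam r σ))
          (cellIndicator r j) n)
        (fun σ => sum_cellLoss_le c hα hr hK hr1 (A.policy ω) hg σ)
        (fun σ j => le_cellLoss_add_cellLoss c hα hr hK hr1 (A.policy ω) hg σ j)
        (fun σ j => visits_nonneg _ (binaryRegression_nonneg (hf1 σ))
          (cellIndicator_nonneg r j) n)
        (fun σ => sum_visits_cell_le c hα hr hr1 (A.policy ω) σ))
  exact ⟨_, _, hclass σ hσ, hv⟩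

/-- The lower bound when every cell carries a bump. -/
theorem le_minimaxExcessRisk_full (hα1 : α < 1) (hβ : 0 < β) (hαβ : α * β ≤ d)
    {Cβ Cβ' τ μmin : ℝ} (hCβ : C ≤ Cβ) (hCβ' : C ≤ Cβ') (hμ : μmin ≤ 1) (hτ : 0 ≤ τ)
    (hact : (K * r) ^ d ≤ r ^ (α * β)) (hn : 16 * r ^ (2 * α) * n ≤ (K : ℝ) ^ d) :
    ((height α c.lam r * (2 * c.rho * r) ^ d * (K : ℝ) ^ d / 8 : ℝ) : EReal) ≤
      minimaxExcessRisk d 2 ⟨α, L, β, Cβ, Cβ', τ, μmin, μmax⟩ n := by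
  obtain ⟨hH0, -, hH2⟩ := height_bounds c hr hα hr1
  have hrho := c.rho_pos
  have hcard : (Fintype.card (Fin d → Fin K) : ℝ) = (K : ℝ) ^ d := by simp
  have hne : (fullSigns (Fin d → Fin K)).Nonempty := ⟨fun _ => 1, by simp [fullSigns]⟩
  refine le_minimaxExcessRisk_of_signs c hα hr hK hr1 hα1 hβ hαβ hCβ hCβ' hμ hτ hne
    (fun σ _ => ?_) (fun σ hσ => ?_) fun R F V hF hpair _ hV => ?_
  · refine le_trans ?_ hact
    rw [mul_pow, ← hcard]
    exact mul_le_mul_of_nonneg_right (by exact_mod_cast Finset.card_le_univ _) (by positivity)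
  · have : Finset.univ.filter (fun j => σ j = 0) = ∅ :=
      Finset.filter_eq_empty_iff.2 fun j _ => (Finset.mem_filter.1 hσ).2 j
    simpa [this] using hτ
  · rw [← hcard]
    refine card_mul_le_sum_fullSigns hF hpair hV (by positivity) (by positivity) ?_
    rw [hcard]
    -- Since `32 H² ≤ 8 r^(2α)`, the factor 16 in `hn` leaves half of the number of cells.
    have := mul_le_mul_of_nonneg_right hH2 (Nat.cast_nonneg (α := ℝ) n)
    linarith

/-- The lower bound when `k` of the cells carry a bump. -/
theorem le_minimaxExcessRisk_sparse (hα1 : α < 1) (hβ : 0 < β) (hαβ : α * β ≤ d)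
    {Cβ Cβ' τ μmin : ℝ} (hCβ : C ≤ Cβ) (hCβ' : C ≤ Cβ') (hμ : μmin ≤ 1) (hτ : 0 ≤ τ) {k : ℕ}
    (hk : k ≠ 0) (hkK : 2 * k ≤ K ^ d) (hact : k * r ^ d ≤ r ^ (α * β)) (hnull : (K * r) ^ d ≤ τ)
    (hn : 64 * r ^ (2 * α) * n ≤ (K : ℝ) ^ d) :
    ((height α c.lam r * (2 * c.rho * r) ^ d * k / 4 : ℝ) : EReal) ≤
      minimaxExcessRisk d 2 ⟨α, L, β, Cβ, Cβ', τ, μmin, μmax⟩ n := by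
  obtain ⟨hH0, -, hH2⟩ := height_bounds c hr hα hr1
  have hrho := c.rho_pos
  have hcard : (Fintype.card (Fin d → Fin K) : ℝ) = (K : ℝ) ^ d := by simp
  have hcard' : Fintype.card (Fin d → Fin K) = K ^ d := by simp
  obtain ⟨k, rfl⟩ := Nat.exists_eq_succ_of_ne_zero hk
  refine le_minimaxExcessRisk_of_signs c hα hr hK hr1 hα1 hβ hαβ hCβ hCβ' hμ hτ
    (sparseSigns_nonempty (J := Fin d → Fin K) (k := k + 1) (by rw [hcard']; omega))
    (fun σ hσ => ?_) (fun σ _ => ?_) fun R F V hF hpair hV0 hV => ?_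
  · rw [(Finset.mem_filter.1 hσ).2]
    exact hact
  · refine le_trans ?_ hnull
    rw [mul_pow, ← hcard]
    exact mul_le_mul_of_nonneg_right (by exact_mod_cast Finset.card_le_univ _) (by positivity)
  · refine card_mul_le_sum_sparseSigns hF hpair hV0 hV (by positivity) (by positivity)
      (by rw [hcard']; omega) ?_
    rw [hcard]
    have := mul_le_mul_of_nonneg_right hH2 (Nat.cast_nonneg (α := ℝ) n)
    linarith

end LowerBounds

/-! ### Choice of the scale and the rates -/

section Rates

variable {d n : ℕ} {α L β C μmax r : ℝ} (c : Constants d α L β C μmax)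

theorem half_le_natFloor {x : ℝ} (hx : 1 ≤ x) : x / 2 ≤ (⌊x⌋₊ : ℝ) := by
  have h1 := Nat.lt_floor_add_one x
  have h2 : (1 : ℝ) ≤ (⌊x⌋₊ : ℝ) := by exact_mod_cast Nat.floor_pos.2 hx
  linarith

theorem exists_rpow_le {e t : ℝ} (he : 0 < e) (ht : 0 < t) :
    ∃ a₀ : ℝ, 0 < a₀ ∧ ∀ a, 0 < a → a ≤ a₀ → a ^ e ≤ t := by
  refine ⟨t ^ (1 / e), by positivity, fun a ha h => ?_⟩
  calc a ^ e ≤ (t ^ (1 / e)) ^ e := Real.rpow_le_rpow ha.le h he.le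
    _ = t := by rw [← Real.rpow_mul ht.le, one_div_mul_cancel he.ne', Real.rpow_one]

/-- The constant in the lower bounds. -/
def Constants.rate (c : Constants d α L β C μmax) : ℝ :=
  c.lam / 4 ^ α * (2 * c.rho) ^ d / 2 ^ d / 8

theorem Constants.rate_pos : 0 < c.rate := by
  have := c.lam_pos
  have := c.rho_pos
  rw [Constants.rate]
  positivity

variable (hα : 0 < α) (hα1 : α < 1) (hβ : 0 < β) (hαβ : α * β ≤ d) (hd : d ≠ 0)
  {Cβ Cβ' τ μmin : ℝ} (hCβ : C ≤ Cβ) (hCβ' : C ≤ Cβ') (hμ : μmin ≤ 1) (hr : 0 < r)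
include hα hα1 hβ hαβ hd hCβ hCβ' hμ hr

/-- The corner has side about `r ^ (α * β / d)`, so that the cells fill the whole active volume `r ^
(α * β)`. The budget condition `r^(2α) n ≲ K^d` then has exponent `2α + d - αβ`. -/
theorem rate_le_minimaxExcessRisk_full (hτ : 0 ≤ τ) (hside : r ^ (α * β / d) ≤ c.side)
    (hn : 16 * 2 ^ d * r ^ (2 * α + d - α * β) * n ≤ 1) :
    ((c.rate * r ^ (α * (β + 1)) : ℝ) : EReal) ≤
      minimaxExcessRisk d 2 ⟨α, L, β, Cβ, Cβ', τ, μmin, μmax⟩ n := by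
  have hd0 : (0 : ℝ) < d := by exact_mod_cast Nat.pos_of_ne_zero hd
  have hab : 0 < α * β := mul_pos hα hβ
  have hlam := c.lam_pos
  have hrho := c.rho_pos
  have hr1 : r ≤ 1 := by
    by_contra h
    have := Real.one_lt_rpow (not_le.1 h) (div_pos hab hd0)
    linarith [c.side_le]
  set q := r ^ (α * β / d) with hq
  have hq0 : 0 < q := by positivity
  have hqd : q ^ d = r ^ (α * β) := by
    rw [hq, ← Real.rpow_natCast, ← Real.rpow_mul hr.le, div_mul_cancel₀ _ hd0.ne']
  have hrq : r ≤ q := by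
    have := Real.rpow_le_rpow_of_exponent_ge hr hr1 ((div_le_one hd0).2 hαβ)
    rwa [Real.rpow_one] at this
  set K := ⌊q / r⌋₊ with hK
  have hz : 1 ≤ q / r := (one_le_div hr).2 hrq
  have hK1 : K * r ≤ q := (le_div_iff₀ hr).1 (Nat.floor_le (by positivity))
  have hK2 : q / 2 ≤ K * r := by
    have := mul_le_mul_of_nonneg_right (half_le_natFloor hz) hr.le
    rwa [div_right_comm, div_mul_cancel₀ _ hr.ne'] at this
  have hKd : r ^ (α * β) / 2 ^ d ≤ (K : ℝ) ^ d * r ^ d := by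
    rw [← hqd, ← div_pow, ← mul_pow]
    exact pow_le_pow_left₀ (by positivity) hK2 d
  have hact : (K * r) ^ d ≤ r ^ (α * β) := by
    rw [← hqd]
    exact pow_le_pow_left₀ (by positivity) hK1 d
  have hsplit : r ^ (2 * α + d - α * β) = r ^ (2 * α) * r ^ d / r ^ (α * β) := by
    rw [Real.rpow_sub hr, Real.rpow_add hr, Real.rpow_natCast]
  have hnK : 16 * r ^ (2 * α) * n ≤ (K : ℝ) ^ d := by
    have h0 : 0 < r ^ (α * β) := by positivity
    have hrd : 0 < r ^ d := by positivity
    refine le_of_mul_le_mul_right (le_trans ?_ hKd) hrd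
    rw [hsplit] at hn
    rw [le_div_iff₀ (by positivity)]
    have e : 16 * 2 ^ d * (r ^ (2 * α) * r ^ d / r ^ (α * β)) * n =
        (16 * r ^ (2 * α) * n * r ^ d * 2 ^ d) / r ^ (α * β) := by ring
    rw [e, div_le_one h0] at hn
    exact hn
  refine le_trans (EReal.coe_le_coe_iff.2 ?_) (le_minimaxExcessRisk_full c hα hr
    (hK1.trans hside) hr1 hα1 hβ hαβ hCβ hCβ' hμ hτ hact hnK)
  have e1 : r ^ (α * (β + 1)) = r ^ α * r ^ (α * β) := by
    rw [← Real.rpow_add hr]; congr 1; ring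
  have e2 : height α c.lam r * (2 * c.rho * r) ^ d * (K : ℝ) ^ d / 8 =
      c.lam / 4 ^ α * (2 * c.rho) ^ d / 8 * r ^ α * ((K : ℝ) ^ d * r ^ d) := by
    rw [height, Real.div_rpow hr.le (by norm_num), mul_pow]
    ring
  rw [e1, e2]
  calc c.rate * (r ^ α * r ^ (α * β)) =
        c.lam / 4 ^ α * (2 * c.rho) ^ d / 8 * r ^ α * (r ^ (α * β) / 2 ^ d) := by
        rw [Constants.rate]; ring
    _ ≤ _ := mul_le_mul_of_nonneg_left hKd (by positivity)

/-- The corner has volume about `side ^ d * τ`, the most that `τ` permits up to a constant, and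
about `r^(αβ) / r^d` of its cells are active; `hmass` keeps these at most half of all cells. -/
theorem rate_le_minimaxExcessRisk_sparse (hτ : 0 < τ) (hτ1 : τ ≤ 1)
    (hmass : 2 ^ (d + 1) * r ^ (α * β) ≤ c.side ^ d * τ)
    (hn : 64 * 2 ^ d * r ^ (2 * α + d) * n ≤ c.side ^ d * τ) :
    ((c.rate * r ^ (α * (β + 1)) : ℝ) : EReal) ≤
      minimaxExcessRisk d 2 ⟨α, L, β, Cβ, Cβ', τ, μmin, μmax⟩ n := by
  have hd0 : (0 : ℝ) < d := by exact_mod_cast Nat.pos_of_ne_zero hd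
  have hab : 0 < α * β := mul_pos hα hβ
  have hlam := c.lam_pos
  have hrho := c.rho_pos
  have hs0 := c.side_pos
  have hs1 : c.side ≤ 1 := by linarith [c.side_le]
  have h2d : (1 : ℝ) ≤ 2 ^ d := one_le_pow₀ one_le_two
  have hab0 : 0 < r ^ (α * β) := by positivity
  have hsd : c.side ^ d ≤ 1 := pow_le_one₀ hs0.le hs1
  have hmass1 : r ^ (α * β) ≤ c.side ^ d * τ := by
    refine le_trans (le_mul_of_one_le_left hab0.le (one_le_pow₀ one_le_two)) hmass
  have hr1 : r ≤ 1 := by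
    by_contra h
    have := Real.one_lt_rpow (not_le.1 h) hab
    nlinarith
  set u := c.side * τ ^ (1 / (d : ℝ)) with hu
  have hu0 : 0 < u := by positivity
  have hud : u ^ d = c.side ^ d * τ := by
    rw [hu, mul_pow, ← Real.rpow_natCast (τ ^ (1 / (d : ℝ))), ← Real.rpow_mul hτ.le,
      one_div_mul_cancel hd0.ne', Real.rpow_one]
  have hus : u ≤ c.side :=
    mul_le_of_le_one_right hs0.le (Real.rpow_le_one hτ.le hτ1 (by positivity))
  have hrd : r ^ d ≤ r ^ (α * β) := by
    rw [← Real.rpow_natCast]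
    exact Real.rpow_le_rpow_of_exponent_ge hr hr1 hαβ
  have hru : r ≤ u := (pow_le_pow_iff_left₀ hr.le hu0.le hd).1 (by rw [hud]; linarith)
  have hrd0 : 0 < r ^ d := by positivity
  set K := ⌊u / r⌋₊
  have hK1 : K * r ≤ u := (le_div_iff₀ hr).1 (Nat.floor_le (by positivity))
  have hK2 : u / 2 ≤ K * r := by
    have := mul_le_mul_of_nonneg_right (half_le_natFloor ((one_le_div hr).2 hru)) hr.le
    rwa [div_right_comm, div_mul_cancel₀ _ hr.ne'] at this
  have hKd : c.side ^ d * τ / 2 ^ d ≤ (K : ℝ) ^ d * r ^ d := by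
    rw [← hud, ← div_pow, ← mul_pow]
    exact pow_le_pow_left₀ (by positivity) hK2 d
  have hnull : (K * r) ^ d ≤ τ := by
    refine (pow_le_pow_left₀ (by positivity) hK1 d).trans ?_
    rw [hud]
    exact mul_le_of_le_one_left hτ.le hsd
  set k := ⌊r ^ (α * β) / r ^ d⌋₊
  have hk1 : 1 ≤ r ^ (α * β) / r ^ d := (one_le_div hrd0).2 hrd
  have hk : k ≠ 0 := (Nat.floor_pos.2 hk1).ne'
  have hact : k * r ^ d ≤ r ^ (α * β) := (le_div_iff₀ hrd0).1 (Nat.floor_le (by positivity))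
  have hk2 : r ^ (α * β) / 2 ≤ k * r ^ d := by
    have := mul_le_mul_of_nonneg_right (half_le_natFloor hk1) hrd0.le
    rwa [div_right_comm, div_mul_cancel₀ _ hrd0.ne'] at this
  have hkK : 2 * k ≤ K ^ d := by
    have : (2 : ℝ) * k ≤ (K : ℝ) ^ d := by
      refine le_of_mul_le_mul_right (le_trans ?_ hKd) hrd0
      rw [le_div_iff₀ (by positivity)]
      rw [pow_succ] at hmass
      have := mul_le_mul_of_nonneg_left hact (show (0 : ℝ) ≤ 2 * 2 ^ d by positivity)
      linarith
    exact_mod_cast this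
  have hnK : 64 * r ^ (2 * α) * n ≤ (K : ℝ) ^ d := by
    refine le_of_mul_le_mul_right (le_trans ?_ hKd) hrd0
    rw [Real.rpow_add hr, Real.rpow_natCast] at hn
    rw [le_div_iff₀ (by positivity)]
    linarith
  refine le_trans (EReal.coe_le_coe_iff.2 ?_) (le_minimaxExcessRisk_sparse c hα hr
    (hK1.trans hus) hr1 hα1 hβ hαβ hCβ hCβ' hμ hτ.le hk hkK hact hnull hnK)
  have e1 : r ^ (α * (β + 1)) = r ^ α * r ^ (α * β) := by
    rw [← Real.rpow_add hr]; congr 1; ring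
  have e2 : height α c.lam r * (2 * c.rho * r) ^ d * k / 4 =
      c.lam / 4 ^ α * (2 * c.rho) ^ d / 4 * r ^ α * (k * r ^ d) := by
    rw [height, Real.div_rpow hr.le (by norm_num), mul_pow]
    ring
  rw [e1, e2]
  calc c.rate * (r ^ α * r ^ (α * β)) =
        c.lam / 4 ^ α * (2 * c.rho) ^ d / 4 * r ^ α * (r ^ (α * β) / 2) / 2 ^ d := by
        rw [Constants.rate]; ring
    _ ≤ c.lam / 4 ^ α * (2 * c.rho) ^ d / 4 * r ^ α * (r ^ (α * β) / 2) :=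
        div_le_self (by positivity) h2d
    _ ≤ _ := mul_le_mul_of_nonneg_left hk2 (by positivity)

end Rates

theorem exists_rate_le_minimaxExcessRisk {d : ℕ} {α L β Cβ Cβ' μmax : ℝ}
    (hα : 0 < α) (hα1 : α < 1) (hL : 1 < L) (hβ : 0 < β) (hCβ : 1 < Cβ) (hCβ' : 1 < Cβ')
    (hαβ : α * β ≤ d) (hμmax : 1 < μmax) :
    ∃ C : ℝ, 0 < C ∧ ∀ τ μmin : ℝ, 0 < τ → τ ≤ 1 → μmin ≤ 1 → ∀ n : ℕ, 1 ≤ n →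
      ((C * max ((τ / n) ^ (α * (β + 1) / (2 * α + d)))
        ((1 / (n : ℝ)) ^ (α * (β + 1) / (2 * α + d - α * β))) : ℝ) : EReal) ≤
      minimaxExcessRisk d 2 ⟨α, L, β, Cβ, Cβ', τ, μmin, μmax⟩ n := by
  have hab : 0 < α * β := mul_pos hα hβ
  have hd : d ≠ 0 := by
    rintro rfl
    simp only [CharP.cast_eq_zero] at hαβ
    linarith
  have hd0 : (0 : ℝ) < d := by exact_mod_cast Nat.pos_of_ne_zero hd
  obtain ⟨c⟩ := exists_constants (d := d) (α := α) (β := β) hd hL (lt_min hCβ hCβ') hμmax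
  have hs := c.side_pos
  have hD : 0 < 2 * α + d := by positivity
  have hD' : 0 < 2 * α + d - α * β := by linarith
  have hE : 0 < α * (β + 1) := by positivity
  obtain ⟨a₁, ha₁, h₁⟩ := exists_rpow_le (div_pos hab hd0) hs
  obtain ⟨a₂, ha₂, h₂⟩ := exists_rpow_le hD' (show (0 : ℝ) < 1 / (16 * 2 ^ d) by positivity)
  obtain ⟨a₃, ha₃, h₃⟩ := exists_rpow_le hab (show 0 < c.side ^ d / 2 ^ (d + 1) by positivity)
  obtain ⟨a₄, ha₄, h₄⟩ := exists_rpow_le hD (show 0 < c.side ^ d / (64 * 2 ^ d) by positivity)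
  -- The scales will be `a * x` and `a * z`; the factor `a` absorbs all constants, uniformly in `n`,
  -- `τ` and `μmin`.
  set a := min (min a₁ a₂) (min a₃ a₄)
  have ha : 0 < a := lt_min (lt_min ha₁ ha₂) (lt_min ha₃ ha₄)
  replace h₁ := h₁ a ha ((min_le_left _ _).trans (min_le_left _ _))
  replace h₂ := h₂ a ha ((min_le_left _ _).trans (min_le_right _ _))
  replace h₃ := h₃ a ha ((min_le_right _ _).trans (min_le_left _ _))
  replace h₄ := h₄ a ha ((min_le_right _ _).trans (min_le_right _ _))
  rw [le_div_iff₀ (by positivity)] at h₂ h₃ h₄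
  refine ⟨c.rate * a ^ (α * (β + 1)), mul_pos c.rate_pos (by positivity),
    fun τ μmin hτ hτ1 hμ n hn => ?_⟩
  have hn1 : (1 : ℝ) ≤ n := by exact_mod_cast hn
  have hn0 : (0 : ℝ) < n := by linarith
  set x := (1 / (n : ℝ)) ^ (1 / (2 * α + d - α * β)) with hx
  set z := (τ / (n : ℝ)) ^ (1 / (2 * α + d)) with hz
  have hx0 : 0 < x := by positivity
  have hz0 : 0 < z := by positivity
  have hx1 : x ≤ 1 := Real.rpow_le_one (by positivity) ((div_le_one hn0).2 hn1) (by positivity)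
  have hxD : x ^ (2 * α + d - α * β) = 1 / n := by
    rw [hx, ← Real.rpow_mul (by positivity), one_div_mul_cancel hD'.ne', Real.rpow_one]
  have hzD : z ^ (2 * α + d) = τ / n := by
    rw [hz, ← Real.rpow_mul (by positivity), one_div_mul_cancel hD.ne', Real.rpow_one]
  have hxE : (1 / (n : ℝ)) ^ (α * (β + 1) / (2 * α + d - α * β)) = x ^ (α * (β + 1)) := by
    rw [hx, ← Real.rpow_mul (by positivity)]; congr 1; ring
  have hzE : (τ / (n : ℝ)) ^ (α * (β + 1) / (2 * α + d)) = z ^ (α * (β + 1)) := by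
    rw [hz, ← Real.rpow_mul (by positivity)]; congr 1; ring
  rw [hxE, hzE]
  have hfull : ((c.rate * a ^ (α * (β + 1)) * x ^ (α * (β + 1)) : ℝ) : EReal) ≤
      minimaxExcessRisk d 2 ⟨α, L, β, Cβ, Cβ', τ, μmin, μmax⟩ n := by
    rw [mul_assoc, ← Real.mul_rpow ha.le hx0.le]
    refine rate_le_minimaxExcessRisk_full c hα hα1 hβ hαβ hd (min_le_left _ _)
      (min_le_right _ _) hμ (mul_pos ha hx0) hτ.le ?_ ?_
    · rw [Real.mul_rpow ha.le hx0.le]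
      exact (mul_le_of_le_one_right (by positivity)
        (Real.rpow_le_one hx0.le hx1 (by positivity))).trans h₁
    · rw [Real.mul_rpow ha.le hx0.le, hxD]
      field_simp
      linarith
  -- The sparse family fits only if its active volume is below `τ`. Otherwise `z^(2α+d-αβ) = (τ / n)
  -- / z^(αβ) < 1 / n`, so `z ≤ x` and the full family already gives the maximum.
  rcases le_or_gt (z ^ (α * β)) τ with hzτ | hzτ
  · have hsparse : ((c.rate * a ^ (α * (β + 1)) * z ^ (α * (β + 1)) : ℝ) : EReal) ≤
        minimaxExcessRisk d 2 ⟨α, L, β, Cβ, Cβ', τ, μmin, μmax⟩ n := by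
      rw [mul_assoc, ← Real.mul_rpow ha.le hz0.le]
      refine rate_le_minimaxExcessRisk_sparse c hα hα1 hβ hαβ hd (min_le_left _ _)
        (min_le_right _ _) hμ (mul_pos ha hz0) hτ hτ1 ?_ ?_
      · rw [Real.mul_rpow ha.le hz0.le]
        have := mul_le_mul h₃ hzτ (by positivity) (by positivity)
        linarith
      · rw [Real.mul_rpow ha.le hz0.le, hzD]
        have e : 64 * 2 ^ d * (a ^ (2 * α + d) * (τ / n)) * n =
            a ^ (2 * α + d) * (64 * 2 ^ d) * τ := by field_simp
        rw [e]
        exact mul_le_mul_of_nonneg_right h₄ hτ.le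
    rcases max_choice (z ^ (α * (β + 1))) (x ^ (α * (β + 1))) with h | h <;> rw [h]
    exacts [hsparse, hfull]
  · have hzx : z ≤ x := by
      refine (Real.rpow_le_rpow_iff hz0.le hx0.le hD').1 ?_
      rw [hxD, Real.rpow_sub hz0, hzD, div_le_iff₀ (by positivity), div_mul_eq_mul_div, one_mul]
      exact div_le_div_of_nonneg_right hzτ.le hn0.le
    rw [max_eq_right (Real.rpow_le_rpow hz0.le hzx hE.le)]
    exact hfull

end ActiveClassification

end

theorem theorem3 (d : ℕ) (α L β Cβ Cβ' μmax : ℝ)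
    (hα : 0 < α) (hα1 : α < 1) (hL : 1 < L) (hβ : 0 < β) (hCβ : 1 < Cβ) (hCβ' : 1 < Cβ')
    (hαβ : α * β ≤ d) (hμmax : 1 < μmax) :
    ∃ C C' : ℝ, 0 < C ∧ 0 < C' ∧
      ∀ τ μmin : ℝ, τ ≤ 1 → 0 < μmin → μmin < 1 → μmin < τ →
        ∀ n : ℕ, 1 ≤ n →
          ((min
            (C * max ((τ / n) ^ (α * (β + 1) / (2 * α + d)))
              ((1 / (n : ℝ)) ^ (α * (β + 1) / (2 * α + d - α * β))))
            (C' * max ((1 / (n : ℝ)) ^ (α * (β + 1) / (2 * α + d)))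
              ((1 / τ) ^ (α * (β + 1) / (2 * α + d)) *
                (1 / (n : ℝ)) ^ (α * (β + 1) / (2 * α + d - α * β)))) : ℝ) : EReal)
            ≤ ActiveClassification.minimaxExcessRisk d 2 ⟨α, L, β, Cβ, Cβ', τ, μmin, μmax⟩ n := by
  obtain ⟨C, hC, h⟩ :=
    ActiveClassification.exists_rate_le_minimaxExcessRisk hα hα1 hL hβ hCβ hCβ' hαβ hμmax
  -- The first entry of the minimum is already a lower bound, so any positive `C'` would do.
  exact ⟨C, C, hC, hC, fun τ μmin hτ1 hμ0 hμ1 hμτ n hn =>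
    (EReal.coe_le_coe_iff.2 (min_le_left _ _)).trans
      (h τ μmin (hμ0.trans hμτ) hτ1 hμ1.le n hn)⟩
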